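/- **Corollary 3.6 (split-up formula for spatial preferential attachment).** Let $\mathbb T_1$ be the one-dimensional torus of length $1$ with its torus metric $d$, and let $\mathcal X=\mathbb T_1\times(0,\infty)$; a point $(x,s)\in\mathcal X$ is a vertex at position $x$ with birth time $s$. Let $\alpha$ be a diffuse measure on $\mathcal X$ (no atoms) with $\alpha(\mathbb T_1\times(0,t])<\infty$ for all $t>0$, let the profile function $\varphi:[0,\infty)\to[0,1]$ be measurable and let the attachment rule be a function $f:\mathbb N_0\to(0,\infty)$. Let $\mathfrak N$ and $\mathfrak N_2$ be the spaces of locally finite simple counting measures, identified with their supports, on $\mathcal X$ and on the set of two-element subsets of $\mathcal X$ (finitely many points in $\mathbb T_1\times(0,t]$, respectively finitely many pairs within $\mathbb T_1\times(0,t]$, for every $t$), each with the $\sigma$-algebra generated by the point counts of measurable sets. For $A\subset\mathcal X$ and a vertex $z\notin A$ write $\langle A,z\rangle=\{\{y,z\}: y\in A\}$. Let $(\Xi,\Sigma)$ be the spatial preferential attachment graph: $\Xi$ is a Poisson point process on $\mathcal X$ with intensity measure $\alpha$ and, given $\Xi$, the edges are constructed successively in time. At its birth, a vertex $(y,t)\in\Xi$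 is connected to each vertex $(x,s)\in\Xi$ with $s<t$ with probability $$\varphi\Bigl(\frac{t\,d(x,y)}{f(Z_{(x,s)}(t-))}\Bigr),$$ independently of all other edges given the graph $(\Xi_{t-},\Sigma_{t-})$ on the vertices born before time $t$. Here $Z_{(x,s)}(t-)$ is the number of vertices born during $(s,t)$ that are connected to $(x,s)$. There are no other edges. Then, for every measurable $h:\mathfrak N\times\mathcal X\times\mathfrak N_2\to[0,\infty]$, $$\mathbb E\Bigl[\int_{\mathcal X} h\bigl(\Xi-\delta_{(x,s)},(x,s),\Sigma|_{\langle\Xi-\delta_{(x,s)},(x,s)\rangle}\bigr)\,\Xi(\mathrm d(x,s))\Bigr]=\int_{\mathcal X}\mathbb E\Bigl[h\bigl(\Xi,(x,s),\Sigma_2^{<s}\cup\Sigma_2^{>s}\bigr)\Bigr]\,\alpha(\mathrm d(x,s)),$$ where, for each $(x,s)$, the outgoing edges $\Sigma_2^{<s}$ and the incoming edges $\Sigma_2^{>s}$ of the additional vertex $(x,s)$ have the product conditional law $$\mathcal L\bigl(\Sigma_2^{<s},\Sigma_2^{>s}\bigm|\Xi,\Sigma\bigr)=\mathcal L\bigl(\Sigma_2^{<s}\bigm|\Xi_{s-},\Sigma_{s-}\bigr)\otimes\mathcal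 L\bigl(\Sigma_2^{>s}\bigm|\Xi\bigr).$$ Given $(\Xi_{s-},\Sigma_{s-})$, the set $\Sigma_2^{<s}$ contains the edges between $(x,s)$ and the vertices $(y,t)\in\Xi_{s-}$ independently of each other, with probabilities $\varphi\bigl(s\,d(x,y)/f(Z_{(y,t)}(s-))\bigr)$. Given $\Xi=\xi$, the set $\Sigma_2^{>s}$ is distributed as the set of edges between $(x,s)$ and the vertices born after time $s$ in the preferential attachment graph with vertex set $\xi+\delta_{(x,s)}$. -/

import Mathlib

open MeasureTheory ProbabilityTheory Set

/-- The quotient `σ`-algebra on unordered pairs. -/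
instance Sym2.instMeasurableSpaceQuot {Y : Type*} [MeasurableSpace Y] : MeasurableSpace (Sym2 Y) :=
  MeasurableSpace.map (fun x : Y × Y => s(x.1, x.2)) inferInstance

namespace SpatialPA

/-- Locally finite simple counting measures on `Y`, identified with their supports: the sets that
have finitely many points in each of the (bounded) windows `W t`. -/
def Config {Y : Type*} (W : ℝ → Set Y) : Type _ := {ξ : Set Y // ∀ t, (ξ ∩ W t).Finite}

namespace Config

variable {Y : Type*} {W : ℝ → Set Y}

/-- The number of points of `ξ` in `B`. -/
noncomputable def count (ξ : Config W) (B : Set Y) : ℕ∞ := (ξ.1 ∩ B).encard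

/-- The smallest `σ`-algebra that renders the point counts of measurable sets measurable. -/
noncomputable instance [MeasurableSpace Y] : MeasurableSpace (Config W) :=
  ⨆ B : {B : Set Y // MeasurableSet B},
    MeasurableSpace.comap (fun ξ : Config W => ξ.count B.1) inferInstance

/-- The restriction `ξ|_B`. -/
def restrict (ξ : Config W) (B : Set Y) : Config W :=
  ⟨ξ.1 ∩ B, fun t => (ξ.2 t).subset fun _ h => ⟨h.1.1, h.2⟩⟩

/-- For a point `p` of `ξ`, the configuration `ξ - δ_p`. -/
def erase (ξ : Config W) (p : Y) : Config W :=
  ⟨ξ.1 \ {p}, fun t => (ξ.2 t).subset fun _ h => ⟨h.1.1, h.2⟩⟩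

/-- For a point `p` that is not in `ξ`, the configuration `ξ + δ_p`. -/
def add (ξ : Config W) (p : Y) : Config W :=
  ⟨insert p ξ.1, fun t => ((ξ.2 t).insert p).subset fun _ h =>
    h.1.elim (fun e => Or.inl e) fun e => Or.inr ⟨e, h.2⟩⟩

/-- The union of two configurations (their sum, if they have no point in common). -/
def union (ξ η : Config W) : Config W :=
  ⟨ξ.1 ∪ η.1, fun t => ((ξ.2 t).union (η.2 t)).subset fun _ h =>
    h.1.elim (fun e => Or.inl ⟨e, h.2⟩) fun e => Or.inr ⟨e, h.2⟩⟩

end Config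

/-- The space `𝕋₁ × (0, ∞)`; a vertex is a position on the torus of length one (whose distance is
`min (|x - y|, 1 - |x - y|)` for representatives in `[0, 1)`) with a birth time. -/
abbrev Vertex : Type := UnitAddCircle × Ioi (0 : ℝ)

/-- The birth time of a vertex. -/
def birth (p : Vertex) : ℝ := p.2

/-- `𝕋₁ × (0, t]`. -/
def bornBy (t : ℝ) : Set Vertex := {p | birth p ≤ t}

/-- `𝕋₁ × (0, t)`. -/
def bornBefore (t : ℝ) : Set Vertex := {p | birth p < t}

/-- The two-element subsets of `𝕋₁ × (0, ∞)`. -/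
abbrev Edge : Type := {e : Sym2 Vertex // ¬ e.IsDiag}

/-- The two-element subsets of `A`. -/
def pairsIn (A : Set Vertex) : Set Edge := {e | ∀ p ∈ e.1, p ∈ A}

/-- The potential edges `⟨A, p⟩` between `A` and `p`. -/
def pairsWith (A : Set Vertex) (p : Vertex) : Set Edge := {e | ∃ y ∈ A, e.1 = s(y, p)}

/-- Vertex configurations: only finitely many vertices are born by any given time. -/
abbrev VertexConfig : Type := Config bornBy

/-- Edge configurations: there are only finitely many edges between the vertices that are born by
any given time. -/
abbrev EdgeConfig : Type := Config fun t => pairsIn (bornBy t)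

/-- The indegree of `p` at time `t-`: the number of edges to `p` from vertices that are younger
than `p` and are born before time `t`. -/
noncomputable def inDeg (σ : EdgeConfig) (p : Vertex) (t : ℝ) : ℕ :=
  {q | birth p < birth q ∧ birth q < t ∧ ∃ e ∈ σ.1, e.1 = s(q, p)}.ncard

/-- The probability with which a newborn vertex `q` is connected to an older vertex `p`
of indegree `k`, for the profile function `φ` and the attachment rule `f`. -/
noncomputable def connProb (φ : ℝ → ℝ) (f : ℕ → ℝ) (q p : Vertex) (k : ℕ) : ℝ :=
  φ (birth q * dist q.1 p.1 / f k)

/-- Marks: one number in `[0, 1]` for every (ordered) pair of vertices. -/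
abbrev Marks : Type := Vertex × Vertex → unitInterval

/-- The law of independent uniform marks. An event `u x < c` has probability `c`, and such events
are independent for different pairs `x`; so these marks realise independent coin tosses. -/
noncomputable def markLaw : Measure Marks := Measure.infinitePi fun _ => volume

theorem card_older_lt {ξ : VertexConfig} {r q : Vertex} (hr : r ∈ ξ.1) (h : birth r < birth q) :
    (ξ.1 ∩ bornBefore (birth r)).ncard < (ξ.1 ∩ bornBefore (birth q)).ncard := by
  refine ncard_lt_ncard ?_ ((ξ.2 (birth q)).subset fun x hx => ⟨hx.1, (show birth x < birth q from hx.2).le⟩)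
  refine ⟨fun x hx => ⟨hx.1, lt_trans hx.2 h⟩, fun hs => ?_⟩
  exact lt_irrefl (birth r) (hs ⟨hr, h⟩).2

/-- The older vertices to which the vertex `q` is connected at its birth in the construction with
vertex set `ξ`: each older vertex `p` of `ξ` is chosen if the mark of `(q, p)` is below the
connection probability of `q` and `p`, where the indegree of `p` just before the birth of `q` is
the number of the vertices `r` born before `q` that were connected to `p` at their birth. -/
noncomputable def targets (φ : ℝ → ℝ) (f : ℕ → ℝ) (ξ : VertexConfig) (u : Marks) (q : Vertex) :
    Set Vertex :=
  {p | p ∈ ξ.1 ∧ birth p < birth q ∧ (u (q, p) : ℝ) < connProb φ f q p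
    {r | ∃ _ : r ∈ ξ.1 ∧ birth r < birth q, p ∈ targets φ f ξ u r}.ncard}
termination_by (ξ.1 ∩ bornBefore (birth q)).ncard
decreasing_by
  rename_i h
  exact card_older_lt h.1 h.2

/-- The edges of the preferential attachment graph with vertex set `ξ`, built with the marks
`u`. -/
noncomputable def graphOf (φ : ℝ → ℝ) (f : ℕ → ℝ) (ξ : VertexConfig) (u : Marks) : EdgeConfig :=
  ⟨{e | ∃ q p, q ∈ ξ.1 ∧ p ∈ targets φ f ξ u q ∧ e.1 = s(q, p)}, fun t => by
    have hF := ((ξ.2 t).prod (ξ.2 t)).image fun x => s(x.1, x.2)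
    refine Finite.of_finite_image (hF.subset ?_) Subtype.val_injective.injOn
    rintro _ ⟨e, ⟨⟨q, p, hq, hp, he⟩, ht⟩, rfl⟩
    rw [targets] at hp
    refine ⟨(q, p), ⟨⟨hq, ht q ?_⟩, hp.1, ht p ?_⟩, he.symm⟩ <;> simp [he]⟩

/-- The recursion that defines the graph: at its birth, a vertex `q` of `ξ` is connected to an
older vertex `p` of `ξ` if and only if the mark of `(q, p)` is below the connection probability,
which is computed from the indegree of `p` in the graph at that time. -/
theorem mem_graphOf_iff (φ : ℝ → ℝ) (f : ℕ → ℝ) (ξ : VertexConfig) (u : Marks) (e : Edge) :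
    e ∈ (graphOf φ f ξ u).1 ↔ ∃ q p, q ∈ ξ.1 ∧ p ∈ ξ.1 ∧ birth p < birth q ∧
      (u (q, p) : ℝ) < connProb φ f q p (inDeg (graphOf φ f ξ u) p (birth q)) ∧
      e.1 = s(q, p) := by
  have key : ∀ q p : Vertex, {r | ∃ _ : r ∈ ξ.1 ∧ birth r < birth q, p ∈ targets φ f ξ u r} =
      {r | birth p < birth r ∧ birth r < birth q ∧
        ∃ e ∈ (graphOf φ f ξ u).1, e.1 = s(r, p)} := by
    intro q p
    ext r
    constructor
    · rintro ⟨⟨h1, h2⟩, h3⟩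
      have h4 : birth p < birth r := by
        rw [targets] at h3
        exact h3.2.1
      refine ⟨h4, h2, ⟨s(r, p), ?_⟩, ⟨r, p, h1, h3, rfl⟩, rfl⟩
      rw [Sym2.mk_isDiag_iff]
      rintro rfl
      exact lt_irrefl _ h4
    · rintro ⟨h1, h2, e', ⟨r', p', h3, h4, h5⟩, h6⟩
      rw [h6, Sym2.eq_iff] at h5
      rcases h5 with ⟨rfl, rfl⟩ | ⟨rfl, rfl⟩
      · exact ⟨⟨h3, h2⟩, h4⟩
      · rw [targets] at h4
        exact absurd h4.2.1 (not_lt.2 h1.le)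
  constructor
  · rintro ⟨q, p, hq, hp, he⟩
    rw [targets] at hp
    obtain ⟨h1, h2, h3⟩ := hp
    rw [key q p] at h3
    exact ⟨q, p, hq, h1, h2, h3, he⟩
  · rintro ⟨q, p, hq, h1, h2, h3, he⟩
    refine ⟨q, p, hq, ?_, he⟩
    rw [targets]
    refine ⟨h1, h2, ?_⟩
    rw [key q p]
    exact h3

/-- The edge kernel of the model: the law of the edges of the preferential attachment graph, given
that its vertex set is `ξ`. -/
noncomputable def edgeLaw (φ : ℝ → ℝ) (f : ℕ → ℝ) (ξ : VertexConfig) : Measure EdgeConfig :=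
  markLaw.map (graphOf φ f ξ)

/-- The edges which a vertex `p` that is added to the graph `(ξ, σ)` sends, at its birth, to the
older vertices, built with the marks `u`. -/
noncomputable def outgoingOf (φ : ℝ → ℝ) (f : ℕ → ℝ) (ξ : VertexConfig) (σ : EdgeConfig)
    (p : Vertex) (u : Marks) : EdgeConfig :=
  ⟨{e | ∃ y ∈ ξ.1, birth y < birth p ∧
      (u (p, y) : ℝ) < connProb φ f p y (inDeg σ y (birth p)) ∧ e.1 = s(p, y)}, fun t => by
    have hF := (ξ.2 t).image fun y => s(p, y)
    refine Finite.of_finite_image (hF.subset ?_) Subtype.val_injective.injOn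
    rintro _ ⟨e, ⟨⟨y, hy, -, -, he⟩, ht⟩, rfl⟩
    exact ⟨y, ⟨hy, ht y (by simp [he])⟩, he.symm⟩⟩

/-- The law of the outgoing edges of the vertex `p = (x, s)` that is added to the graph
`(ξ, σ) = (Ξ_{s-}, Σ_{s-})`. -/
noncomputable def outgoingLaw (φ : ℝ → ℝ) (f : ℕ → ℝ) (ξ : VertexConfig) (σ : EdgeConfig)
    (p : Vertex) : Measure EdgeConfig :=
  markLaw.map (outgoingOf φ f ξ σ p)

/-- The law of the incoming edges of the vertex `p` that is added to the vertex set `ξ`: the edges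
between `p` and the vertices born after `p` in the preferential attachment graph with vertex set
`ξ + δ_p`. -/
noncomputable def incomingLaw (φ : ℝ → ℝ) (f : ℕ → ℝ) (ξ : VertexConfig) (p : Vertex) :
    Measure EdgeConfig :=
  (edgeLaw φ f (ξ.add p)).map fun σ => σ.restrict (pairsWith (bornBy (birth p))ᶜ p)

/-- `Ξ` is a Poisson point process with intensity measure `α`. -/
structure IsPoissonProcess {Ω : Type*} [MeasurableSpace Ω] (α : Measure Vertex) (P : Measure Ω)
    (Ξ : Ω → VertexConfig) : Prop where
  measurable : Measurable Ξ
  count_law : ∀ B : Set Vertex, MeasurableSet B → α B ≠ ⊤ →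
    P.map (fun ω => (Ξ ω).count B) =
      (poissonMeasure (α B).toNNReal).map (fun n : ℕ => (n : ℕ∞))
  indep : ∀ (n : ℕ) (B : Fin n → Set Vertex), (∀ i, MeasurableSet (B i)) →
    Pairwise (fun i j => Disjoint (B i) (B j)) → iIndepFun (fun i ω => (Ξ ω).count (B i)) P

/-- `(Ξ, G)` is (a version of) the vertex set and the edge set of the spatial preferential
attachment model: `Ξ` is a Poisson point process with intensity measure `α`, and the conditional law
of `G` given `Ξ` is `edgeLaw φ f Ξ`. -/
structure IsSpatialPA {Ω : Type*} [MeasurableSpace Ω] (α : Measure Vertex) (φ : ℝ → ℝ)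
    (f : ℕ → ℝ) (P : Measure Ω) (Ξ : Ω → VertexConfig) (G : Ω → EdgeConfig) : Prop where
  poisson : IsPoissonProcess α P Ξ
  measurable_edges : Measurable G
  cond_law : ∀ (A : Set VertexConfig) (B : Set EdgeConfig), MeasurableSet A → MeasurableSet B →
    P (Ξ ⁻¹' A ∩ G ⁻¹' B) = ∫⁻ ω in Ξ ⁻¹' A, edgeLaw φ f (Ξ ω) B ∂P

end SpatialPA

open SpatialPA

/-! Given `Ξ`, the edges can be integrated out with the kernel `edgeLaw`. The left side then becomes
the mean of a sum, over the points `p` of `Ξ`, of a function of `Ξ - δ_p` and `p`. The Mecke formula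
(`IsPoissonProcess.mecke`) turns it into an integral over `α` in which `p` is added to `Ξ`. Since
`α` is diffuse, a given `p` almost surely is not in `Ξ`, and it remains to treat a fixed
configuration `ξ` and a fixed `p` outside it (`lintegral_edgeLaw_add`).

For fixed vertices the graph is a function of independent marks, one per ordered pair (younger,
older). The graph on `ξ` reads marks of pairs in `ξ`. The edges sent by `p` read the marks `(p, y)`
and the graph of the vertices born before `p`, which `p` does not affect. The edges sent to `p`
depend on no indegree other than that of `p` itself, so they read only the marks `(q, p)`. These
three families of marks are disjoint. Hence the incoming edges are independent of the graph on `ξ`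
and of the outgoing edges, while the outgoing edges are built with fresh marks from the old graph;
this is the product law.

Two points are measure-theoretic. The Mecke formula is checked on void events times bounded sets,
where it is a computation with Poisson probabilities, and void events generate the `σ`-algebra
(`Config.measurable_of_void`). The marks have an uncountable index set, so their evaluation at a
variable pair is not jointly measurable; labelling vertices by their rank in the configuration gives
a countable family of marks and the same law of the graph (`measurable_and_map_infinitePi_eq`). -/

namespace SpatialPA

/-! ### Measurability on configuration spaces -/

/-- The windows `W` are measurable, increasing and exhaust the whole space. -/
class Exhausting {Y : Type*} [MeasurableSpace Y] (W : ℝ → Set Y) : Prop where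
  measurableSet : ∀ t, MeasurableSet (W t)
  mono : Monotone W
  exists_mem : ∀ y, ∃ t, y ∈ W t

theorem Config.tsum_indicator {Y : Type*} {W : ℝ → Set Y} (ξ : Config W) (B : Set Y) :
    ∑' p : ξ.1, B.indicator (1 : Y → ENNReal) p = (ξ.count B : ENNReal) := by
  rw [tsum_subtype (s := ξ.1) (f := B.indicator (1 : Y → ENNReal)), indicator_indicator,
    ← tsum_subtype]
  simp [count]

section Exhausting

variable {Y : Type*} [MeasurableSpace Y] {W : ℝ → Set Y}

theorem Exhausting.exists_nat_mem (W : ℝ → Set Y) [hW : Exhausting W] (y : Y) :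
    ∃ n : ℕ, y ∈ W n := by
  obtain ⟨t, ht⟩ := hW.exists_mem y
  obtain ⟨n, hn⟩ := exists_nat_ge t
  exact ⟨n, hW.mono hn ht⟩

theorem Exhausting.exists_nat_subset (W : ℝ → Set Y) [hW : Exhausting W] {F : Set Y}
    (hF : F.Finite) : ∃ n : ℕ, F ⊆ W n := by
  choose n hn using fun y => Exhausting.exists_nat_mem W y
  refine ⟨hF.toFinset.sup n, fun y hy => hW.mono ?_ (hn y)⟩
  exact_mod_cast Finset.le_sup (f := n) (hF.mem_toFinset.2 hy)

namespace Config

theorem countable [Exhausting W] (ξ : Config W) : ξ.1.Countable := by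
  have : ξ.1 = ⋃ n : ℕ, ξ.1 ∩ W n := by
    rw [← inter_iUnion]
    refine (inter_eq_left.2 fun y _ => ?_).symm
    exact mem_iUnion.2 (Exhausting.exists_nat_mem W y)
  rw [this]
  exact countable_iUnion fun n => (ξ.2 n).countable

instance [Exhausting W] (ξ : Config W) : Countable ξ.1 := ξ.countable.to_subtype

theorem measurable_count {B : Set Y} (hB : MeasurableSet B) :
    Measurable fun ξ : Config W => ξ.count B :=
  Measurable.of_comap_le (le_iSup (fun B : {B : Set Y // MeasurableSet B} =>
    MeasurableSpace.comap (fun ξ : Config W => ξ.count B.1) inferInstance) ⟨B, hB⟩)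

theorem measurable_iff {A : Type*} [MeasurableSpace A] {ξ : A → Config W} :
    Measurable ξ ↔ ∀ B, MeasurableSet B → Measurable fun a => (ξ a).count B := by
  refine ⟨fun h B hB => (measurable_count hB).comp h, fun h => ?_⟩
  refine Measurable.of_le_map (iSup_le fun B => ?_)
  rw [MeasurableSpace.comap_le_iff_le_map, MeasurableSpace.map_comp]
  exact (h B.1 B.2).le_map

/-- The sum of the Dirac measures at the points of `ξ` in the window `W t`. -/
noncomputable def windowMeasure (ξ : Config W) (t : ℝ) : Measure Y :=
  Measure.sum fun p : (ξ.restrict (W t)).1 => Measure.dirac (p : Y)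

theorem windowMeasure_apply [Exhausting W] (ξ : Config W) (t : ℝ) {B : Set Y}
    (hB : MeasurableSet B) : ξ.windowMeasure t B = (ξ.count (W t ∩ B) : ENNReal) := by
  rw [windowMeasure, Measure.sum_apply _ hB]
  simp_rw [Measure.dirac_apply' _ hB]
  rw [tsum_indicator]
  simp [count, restrict, inter_assoc]

theorem lintegral_windowMeasure [Exhausting W] (ξ : Config W) (t : ℝ) {g : Y → ENNReal}
    (hg : Measurable g) :
    ∫⁻ p, g p ∂ξ.windowMeasure t = ∑' p : ξ.1, (W t).indicator g p := by
  rw [windowMeasure, lintegral_sum_measure]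
  simp_rw [lintegral_dirac' _ hg]
  rw [tsum_subtype (s := ξ.1) (f := (W t).indicator g), indicator_indicator,
    tsum_subtype (s := (ξ.restrict (W t)).1) (f := g)]
  rfl

theorem measurable_windowMeasure [hW : Exhausting W] (t : ℝ) :
    Measurable fun ξ : Config W => ξ.windowMeasure t := by
  refine Measure.measurable_of_measurable_coe _ fun B hB => ?_
  simp_rw [windowMeasure_apply _ _ hB]
  exact Measurable.of_discrete.comp (measurable_count ((hW.measurableSet t).inter hB))

instance [Exhausting W] (ξ : Config W) (t : ℝ) : IsFiniteMeasure (ξ.windowMeasure t) := by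
  refine ⟨?_⟩
  rw [windowMeasure_apply _ _ MeasurableSet.univ, inter_univ, count]
  simpa using ξ.2 t

variable {A : Type*} [MeasurableSpace A]

/-- The window measures are finite for each configuration, but without a uniform bound. Pointwise
finiteness still makes the measures of sections measurable, and induction on `g` does the rest. -/
theorem measurable_lintegral_windowMeasure [Exhausting W] {ξ : A → Config W} (hξ : Measurable ξ)
    (t : ℝ) {g : A × Y → ENNReal} (hg : Measurable g) :
    Measurable fun a => ∫⁻ p, g (a, p) ∂(ξ a).windowMeasure t := by
  let κ : Kernel A Y := ⟨fun a => (ξ a).windowMeasure t, (measurable_windowMeasure t).comp hξ⟩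
  have hκ : ∀ a, IsFiniteMeasure (κ a) := fun a =>
    inferInstanceAs (IsFiniteMeasure ((ξ a).windowMeasure t))
  change Measurable fun a => ∫⁻ p, g (a, p) ∂κ a
  refine Measurable.ennreal_induction
    (motive := fun g => Measurable fun a => ∫⁻ p, g (a, p) ∂κ a) ?_ ?_ ?_ hg
  · intro c s hs
    have : ∀ a, ∫⁻ p, s.indicator (fun _ => c) (a, p) ∂κ a = c * κ a (Prod.mk a ⁻¹' s) := by
      intro a
      rw [← lintegral_indicator_const (measurable_prodMk_left hs)]
      rfl
    simp_rw [this]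
    exact (Kernel.measurable_kernel_prodMk_left_of_finite hs hκ).const_mul c
  · intro f g _ hf _ h1 h2
    simp only [Pi.add_apply]
    have : ∀ a, ∫⁻ p, f (a, p) + g (a, p) ∂κ a = ∫⁻ p, f (a, p) ∂κ a + ∫⁻ p, g (a, p) ∂κ a :=
      fun a => lintegral_add_left (hf.comp measurable_prodMk_left) _
    simp_rw [this]
    exact h1.add h2
  · intro f hf hm h
    have : ∀ a, ∫⁻ p, ⨆ n, f n (a, p) ∂κ a = ⨆ n, ∫⁻ p, f n (a, p) ∂κ a :=
      fun a => lintegral_iSup (fun n => (hf n).comp measurable_prodMk_left)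
        fun i j hij p => hm hij _
    simp_rw [this]
    exact Measurable.iSup h

/-- Each finite partial sum involves points of a single window, since the windows increase to the
whole space. -/
theorem tsum_eq_iSup [hW : Exhausting W] (ξ : Config W) (g : Y → ENNReal) :
    ∑' p : ξ.1, g p = ⨆ n : ℕ, ∑' p : ξ.1, (W n).indicator g p := by
  refine le_antisymm ?_ (iSup_le fun n => ENNReal.tsum_le_tsum fun p =>
    indicator_le_self' (fun _ _ => bot_le) _)
  rw [ENNReal.tsum_eq_iSup_sum]
  refine iSup_le fun s => ?_
  obtain ⟨n, hn⟩ := Exhausting.exists_nat_subset W (s.finite_toSet.image Subtype.val)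
  refine le_iSup_of_le n (le_trans (le_of_eq ?_) (ENNReal.sum_le_tsum s))
  refine Finset.sum_congr rfl fun p hp => ?_
  rw [indicator_of_mem (hn ⟨p, hp, rfl⟩)]

/-- A sum over the points of a random configuration is measurable. -/
theorem measurable_tsum [Exhausting W] {ξ : A → Config W} (hξ : Measurable ξ)
    {g : A → Y → ENNReal} (hg : Measurable fun x : A × Y => g x.1 x.2) :
    Measurable fun a => ∑' p : (ξ a).1, g a p := by
  have h := fun a => tsum_eq_iSup (ξ a) (g a)
  simp only [h]
  refine Measurable.iSup fun n => ?_
  have h1 := measurable_lintegral_windowMeasure hξ n hg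
  have h2 := fun a => lintegral_windowMeasure (ξ a) n (hg.comp (measurable_prodMk_left (x := a)))
  simp only [Function.comp_def] at h2
  simpa only [h2] using h1

theorem measurable_encard [Exhausting W] {ξ : A → Config W} (hξ : Measurable ξ)
    {S : A → Set Y} (hS : MeasurableSet {x : A × Y | x.2 ∈ S x.1}) :
    Measurable fun a => ((ξ a).1 ∩ S a).encard := by
  have h := measurable_tsum hξ (g := fun a => (S a).indicator 1)
    ((measurable_one (α := ENNReal)).indicator hS)
  simp only [tsum_indicator] at h
  refine ENat.measurable_iff.2 fun k => ?_
  convert h (measurableSet_singleton (k : ENNReal)) using 1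
  ext a
  simp only [mem_preimage, mem_singleton_iff, count]
  norm_cast

theorem measurable_ncard [Exhausting W] {ξ : A → Config W} (hξ : Measurable ξ)
    {S : A → Set Y} (hS : MeasurableSet {x : A × Y | x.2 ∈ S x.1}) :
    Measurable fun a => ((ξ a).1 ∩ S a).ncard :=
  Measurable.of_discrete.comp (measurable_encard hξ hS)

theorem measurableSet_exists [Exhausting W] {ξ : A → Config W} (hξ : Measurable ξ)
    {S : A → Y → Prop} (hS : MeasurableSet {x : A × Y | S x.1 x.2}) :
    MeasurableSet {a | ∃ p ∈ (ξ a).1, S a p} := by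
  have := measurable_encard hξ (S := fun a => {p | S a p}) hS
    (measurableSet_singleton (0 : ℕ∞)).compl
  convert this using 1
  ext a
  simp [Set.eq_empty_iff_forall_notMem]

theorem measurableSet_mem [Exhausting W] [MeasurableEq Y] {ξ : A → Config W} (hξ : Measurable ξ)
    {g : A → Y} (hg : Measurable g) : MeasurableSet {a | g a ∈ (ξ a).1} := by
  have := measurableSet_exists hξ (S := fun a p => p = g a)
    (measurableSet_eq_fun measurable_snd (hg.comp measurable_fst))
  simpa using this

/-- The first `m` bits of an injective code cut the space into finitely many cells, and finitely
many distinct points lie in distinct cells once `m` is large. So a lower bound for a count says that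
enough cells are hit, which involves only countably many void events of bounded sets. -/
theorem le_count_iff [Exhausting W] {code : Y → ℕ → Bool} (hc : Function.Injective code)
    (ξ : Config W) (B : Set Y) (k : ℕ) :
    (k : ℕ∞) ≤ ξ.count B ↔ ∃ n m : ℕ, ∃ T : Finset (Fin m → Bool), T.card = k ∧
      ∀ s ∈ T, (ξ.1 ∩ (B ∩ W n ∩ {y | ∀ i : Fin m, code y i = s i})).Nonempty := by
  constructor
  · intro h
    obtain ⟨F, hF, hk⟩ := exists_subset_encard_eq h
    have hfin : F.Finite := finite_of_encard_eq_coe hk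
    obtain ⟨n, hn⟩ := Exhausting.exists_nat_subset W hfin
    have hd : ∀ x : Y × Y, ∃ i, x.1 ≠ x.2 → code x.1 i ≠ code x.2 i := fun x => by
      by_cases hx : x.1 = x.2
      · exact ⟨0, fun h => absurd hx h⟩
      · obtain ⟨i, hi⟩ := Function.ne_iff.1 (hc.ne hx)
        exact ⟨i, fun _ => hi⟩
    choose d hd using hd
    classical
    -- `d` gives a bit at which two distinct points differ; one more than its maximum over all pairs
    -- from `F` is enough bits to separate `F`.
    have hinj : InjOn (fun y (i : Fin ((hfin.toFinset ×ˢ hfin.toFinset).sup d + 1)) => code y i)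
        (hfin.toFinset : Set Y) := by
      intro y hy y' hy' hyy
      by_contra hne
      refine hd (y, y') hne (congrFun hyy ⟨d (y, y'), Nat.lt_succ_of_le ?_⟩)
      exact Finset.le_sup (f := d) (Finset.mk_mem_product hy hy')
    refine ⟨n, _, hfin.toFinset.image _, (Finset.card_image_of_injOn hinj).trans ?_, ?_⟩
    · rw [hfin.encard_eq_coe_toFinset_card] at hk
      exact_mod_cast hk
    · intro s hs
      obtain ⟨y, hy, rfl⟩ := Finset.mem_image.1 hs
      have hy' := hfin.mem_toFinset.1 hy
      exact ⟨y, (hF hy').1, ⟨(hF hy').2, hn hy'⟩, fun i => rfl⟩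
  · rintro ⟨n, m, T, rfl, h⟩
    rcases T.eq_empty_or_nonempty with rfl | ⟨s₀, hs₀⟩
    · simp
    have : Nonempty Y := ⟨(h s₀ hs₀).some⟩
    choose! y hy using h
    rw [← encard_coe_eq_coe_finsetCard]
    refine encard_le_encard_of_injOn (f := y) (fun s hs => ⟨(hy s hs).1, (hy s hs).2.1.1⟩) ?_
    intro s hs s' hs' hss
    ext1 i
    rw [← (hy s hs).2.2 i, ← (hy s' hs').2.2 i, hss]

/-- A map into the space of configurations is measurable if the events that bounded measurable
sets contain no point are measurable. -/
theorem measurable_of_void [hW : Exhausting W] [MeasurableSpace.CountablySeparated Y]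
    {ξ : A → Config W}
    (h : ∀ B, MeasurableSet B → (∃ n : ℕ, B ⊆ W n) → MeasurableSet {a | (ξ a).1 ∩ B = ∅}) :
    Measurable ξ := by
  obtain ⟨code, hcm, hc⟩ := MeasurableSpace.measurable_injection_nat_bool_of_countablySeparated Y
  have hle : ∀ (k : ℕ) (B : Set Y), MeasurableSet B →
      MeasurableSet {a | (k : ℕ∞) ≤ (ξ a).count B} := by
    intro k B hB
    simp_rw [le_count_iff hc]
    simp only [ofPred_exists, ofPred_and]
    refine MeasurableSet.iUnion fun n => MeasurableSet.iUnion fun m => MeasurableSet.iUnion fun T =>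
      (MeasurableSet.const _).inter ?_
    simp only [ofPred_forall]
    refine MeasurableSet.iInter fun s => MeasurableSet.iInter fun _ => ?_
    have h1 : MeasurableSet {y | ∀ i : Fin m, code y i = s i} := by
      rw [ofPred_forall]
      exact MeasurableSet.iInter fun i =>
        measurableSet_eq_fun ((measurable_pi_apply _).comp hcm) measurable_const
    convert (h _ ((hB.inter (hW.measurableSet n)).inter h1)
      ⟨n, inter_subset_left.trans inter_subset_right⟩).compl using 1
    ext a
    simp [nonempty_iff_ne_empty, ofPred_forall]
  rw [measurable_iff]
  intro B hB
  refine ENat.measurable_iff.2 fun k => ?_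
  convert (hle k B hB).diff (hle (k + 1) B hB) using 1
  ext a
  simp only [mem_preimage, mem_singleton_iff, mem_sdiff, mem_ofPred_eq, not_le, Nat.cast_add,
    Nat.cast_one]
  constructor
  · rintro h
    rw [h]
    exact ⟨le_rfl, by exact_mod_cast Nat.lt_succ_self k⟩
  · rintro ⟨h1, h2⟩
    exact le_antisymm (ENat.lt_add_one_iff (by simp) |>.1 h2) h1

theorem measurableSet_void {B : Set Y} (hB : MeasurableSet B) :
    MeasurableSet {ξ : Config W | ξ.1 ∩ B = ∅} := by
  convert measurable_count (W := W) hB (measurableSet_singleton 0) using 1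
  ext ξ
  simp [count]

/-- These events form a `π`-system, as avoiding `B` and `C` means avoiding `B ∪ C`; uniqueness in
the Mecke formula rests on it. The nontrivial inclusion is `measurable_of_void` for the identity map
out of the generated `σ`-algebra. -/
theorem generateFrom_void [hW : Exhausting W] [MeasurableSpace.CountablySeparated Y] :
    MeasurableSpace.generateFrom {S : Set (Config W) | ∃ B, MeasurableSet B ∧
      (∃ n : ℕ, B ⊆ W n) ∧ S = {ξ | ξ.1 ∩ B = ∅}} = (inferInstance : MeasurableSpace (Config W)) := by
  refine le_antisymm (MeasurableSpace.generateFrom_le ?_) ?_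
  · rintro _ ⟨B, hB, -, rfl⟩
    exact measurableSet_void hB
  · have := @measurable_of_void Y _ W (Config W) (MeasurableSpace.generateFrom
      {S : Set (Config W) | ∃ B, MeasurableSet B ∧
      (∃ n : ℕ, B ⊆ W n) ∧ S = {ξ | ξ.1 ∩ B = ∅}}) _ _ id
      fun B hB hn => MeasurableSpace.measurableSet_generateFrom ⟨B, hB, hn, rfl⟩
    exact fun s hs => this hs

end Config

end Exhausting

/-! ### Measurable structure of vertices and edges -/

theorem measurableEq_of_countablySeparated (Y : Type*) [MeasurableSpace Y]
    [MeasurableSpace.CountablySeparated Y] : MeasurableEq Y := by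
  obtain ⟨code, hcm, hc⟩ := MeasurableSpace.measurable_injection_nat_bool_of_countablySeparated Y
  refine ⟨?_⟩
  convert measurableSet_eq_fun (hcm.comp measurable_fst) (hcm.comp (measurable_snd (α := Y)))
    using 1
  ext x
  exact hc.eq_iff.symm

section Sym2

variable {Y : Type*} [MeasurableSpace Y]

theorem measurable_sym2Mk : Measurable fun x : Y × Y => s(x.1, x.2) :=
  fun _ h => h

theorem measurable_sym2_iff {Z : Type*} [MeasurableSpace Z] {g : Sym2 Y → Z} :
    Measurable g ↔ Measurable fun x : Y × Y => g s(x.1, x.2) :=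
  ⟨fun h => h.comp measurable_sym2Mk, fun h _ hs => h hs⟩

theorem measurableSet_sym2_iff {S : Set (Sym2 Y)} :
    MeasurableSet S ↔ MeasurableSet {x : Y × Y | s(x.1, x.2) ∈ S} := Iff.rfl

/-- The separating events are that some endpoint lies in a basic open set. An endpoint of `e` that
is not one of `e'` has a basic neighbourhood free of the finite, hence closed, set of endpoints of
`e'`. -/
instance Sym2.instCountablySeparated [TopologicalSpace Y] [SecondCountableTopology Y] [T1Space Y]
    [OpensMeasurableSpace Y] : MeasurableSpace.CountablySeparated (Sym2 Y) := by
  refine ⟨⟨(fun A : Set Y => {e : Sym2 Y | ∃ z ∈ e, z ∈ A}) ''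
    TopologicalSpace.countableBasis Y, (TopologicalSpace.countable_countableBasis Y).image _,
    ?_, ?_⟩⟩
  · rintro _ ⟨A, hA, rfl⟩
    have hA' := ((TopologicalSpace.isBasis_countableBasis Y).isOpen hA).measurableSet
    rw [measurableSet_sym2_iff]
    convert (measurable_fst hA').union (measurable_snd hA') using 1
    ext x
    simp
  · have key : ∀ e e' : Sym2 Y, (∀ A ∈ TopologicalSpace.countableBasis Y,
        ((∃ z ∈ e, z ∈ A) ↔ ∃ z ∈ e', z ∈ A)) → ∀ z ∈ e, z ∈ e' := by
      intro e e' h z hz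
      by_contra hz'
      have hfin : {w | w ∈ e'}.Finite := by
        induction e' with
        | _ x y => exact (Set.toFinite {x, y}).subset fun w hw => by simpa using hw
      obtain ⟨A, hA, hzA, hAe⟩ := (TopologicalSpace.isBasis_countableBasis
        Y).exists_subset_of_mem_open (show z ∈ {w | w ∈ e'}ᶜ from hz') hfin.isClosed.isOpen_compl
      obtain ⟨w, hw, hwA⟩ := (h A hA).1 ⟨z, hz, hzA⟩
      exact hAe hwA hw
    intro e _ e' _ h
    have h' : ∀ A ∈ TopologicalSpace.countableBasis Y,
        ((∃ z ∈ e, z ∈ A) ↔ ∃ z ∈ e', z ∈ A) := fun A hA => h _ ⟨A, hA, rfl⟩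
    exact Sym2.ext fun z => ⟨key e e' h' z, key e' e (fun A hA => (h' A hA).symm) z⟩

end Sym2

instance : MeasurableEq (Sym2 Vertex) := measurableEq_of_countablySeparated _

instance : MeasurableSpace.CountablySeparated Edge :=
  MeasurableSpace.CountablySeparated.subtype_iff.2
    (MeasurableSpace.CountablySeparated.countably_separated.mono (fun _ h => h) (subset_univ _))

instance : MeasurableEq Edge := measurableEq_of_countablySeparated _

theorem measurable_birth : Measurable birth := measurable_subtype_coe.comp measurable_snd

theorem measurableSet_bornBy (t : ℝ) : MeasurableSet (bornBy t) :=
  measurableSet_le measurable_birth measurable_const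

theorem measurableSet_bornBefore (t : ℝ) : MeasurableSet (bornBefore t) :=
  measurableSet_lt measurable_birth measurable_const

theorem measurableSet_pairsIn {A : Set Vertex} (hA : MeasurableSet A) :
    MeasurableSet (pairsIn A) := by
  refine measurable_subtype_coe (t := {e : Sym2 Vertex | ∀ p ∈ e, p ∈ A}) ?_
  rw [measurableSet_sym2_iff]
  convert (measurable_fst hA).inter (measurable_snd hA) using 1
  ext x
  simp only [mem_ofPred_eq, Sym2.mem_iff, forall_eq_or_imp, forall_eq]
  rfl

theorem measurableSet_pairsWith {A : Set Vertex} (hA : MeasurableSet A) (p : Vertex) :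
    MeasurableSet (pairsWith A p) := by
  refine measurable_subtype_coe (t := {e : Sym2 Vertex | ∃ y ∈ A, e = s(y, p)}) ?_
  rw [measurableSet_sym2_iff]
  convert ((measurable_fst hA).inter (measurable_snd (measurableSet_singleton p))).union
    ((measurable_snd hA).inter (measurable_fst (measurableSet_singleton p))) using 1
  ext ⟨x, y⟩
  simp only [Sym2.eq_iff, mem_ofPred_eq, mem_union, mem_inter_iff, mem_preimage, mem_singleton_iff]
  constructor
  · rintro ⟨z, hz, ⟨rfl, rfl⟩ | ⟨rfl, rfl⟩⟩
    · exact Or.inl ⟨hz, rfl⟩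
    · exact Or.inr ⟨hz, rfl⟩
  · rintro (⟨h, rfl⟩ | ⟨h, rfl⟩)
    · exact ⟨x, h, Or.inl ⟨rfl, rfl⟩⟩
    · exact ⟨y, h, Or.inr ⟨rfl, rfl⟩⟩

theorem measurableSet_isDiag : MeasurableSet {e : Sym2 Vertex | e.IsDiag} := by
  rw [measurableSet_sym2_iff]
  simpa using measurableSet_eq_fun (measurable_fst (α := Vertex)) (measurable_snd (β := Vertex))

theorem measurableSet_image_edge {B : Set Edge} (hB : MeasurableSet B) :
    MeasurableSet (Subtype.val '' B) :=
  MeasurableSet.subtype_image measurableSet_isDiag.compl hB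

instance : Exhausting bornBy where
  measurableSet := measurableSet_bornBy
  mono _ _ h p hp := le_trans (show birth p ≤ _ from hp) h
  exists_mem p := ⟨birth p, le_refl (birth p)⟩

instance : Exhausting fun t => pairsIn (bornBy t) where
  measurableSet t := measurableSet_pairsIn (measurableSet_bornBy t)
  mono _ _ h e he p hp := le_trans (show birth p ≤ _ from he p hp) h
  exists_mem e := by
    obtain ⟨e, he⟩ := e
    induction e with
    | _ x y =>
      refine ⟨max (birth x) (birth y), fun p hp => ?_⟩
      rcases Sym2.mem_iff.1 hp with rfl | rfl
      · exact le_max_left (birth p) (birth y)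
      · exact le_max_right (birth x) (birth p)

/-! ### Measurability of operations on configurations -/

namespace Config

variable {Y : Type*} [MeasurableSpace Y] {W : ℝ → Set Y} [Exhausting W]
  [MeasurableSpace.CountablySeparated Y] {A : Type*} [MeasurableSpace A]

theorem measurable_restrict {B : Set Y} (hB : MeasurableSet B) :
    Measurable fun ξ : Config W => ξ.restrict B :=
  measurable_of_void fun C hC _ => by
    simpa only [restrict, inter_assoc] using measurableSet_void (hB.inter hC)

theorem measurable_union : Measurable fun x : Config W × Config W => x.1.union x.2 :=
  measurable_of_void fun C hC _ => by
    simp only [union, union_inter_distrib_right, union_empty_iff]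
    exact (measurable_fst (measurableSet_void hC)).inter (measurable_snd (measurableSet_void hC))

theorem measurable_erase {ξ : A → Config W} (hξ : Measurable ξ) {p : A → Y} (hp : Measurable p) :
    Measurable fun a => (ξ a).erase (p a) :=
  measurable_of_void fun C hC _ => by
    have := measurableEq_of_countablySeparated Y
    have h := (measurableSet_exists hξ (S := fun a q => q ≠ p a ∧ q ∈ C)
      ((measurableSet_eq_fun measurable_snd (hp.comp measurable_fst)).compl.inter
        (measurable_snd hC))).compl
    convert h using 1
    ext a
    simp [erase, eq_empty_iff_forall_notMem]

theorem measurable_add {ξ : A → Config W} (hξ : Measurable ξ) {p : A → Y} (hp : Measurable p) :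
    Measurable fun a => (ξ a).add (p a) :=
  measurable_of_void fun C hC _ => by
    convert (hξ (measurableSet_void hC)).inter (hp hC).compl using 1
    ext a
    simp only [add, eq_empty_iff_forall_notMem, mem_inter_iff, mem_insert_iff, mem_ofPred_eq,
      mem_preimage, mem_compl_iff]
    constructor
    · exact fun h => ⟨fun x hx => h x ⟨Or.inr hx.1, hx.2⟩, fun hx => h _ ⟨Or.inl rfl, hx⟩⟩
    · rintro ⟨h1, h2⟩ x ⟨rfl | hx, hx'⟩
      · exact h2 hx'
      · exact h1 x ⟨hx, hx'⟩

end Config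

/-! ### The Mecke formula -/

/-- The points counted are those of `C` whose removal leaves nothing in `B`. If `X` misses `B`,
these are all points in `C \ B`. Otherwise there is at most one: the only point of `X` in `B`,
provided that it lies in `C`. -/
theorem encard_inter_subset_singleton {Y : Type*} (X B C : Set Y) :
    ((X ∩ {p | X ∩ B ⊆ {p} ∧ p ∈ C}).encard : ENNReal) =
      ((X ∩ (C \ B)).encard : ENNReal) * (if (X ∩ B).encard = 0 then 1 else 0) +
      if (X ∩ (B ∩ C)).encard = 1 ∧ (X ∩ (B \ C)).encard = 0 then 1 else 0 := by
  by_cases h0 : X ∩ B = ∅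
  · have h1 : X ∩ (B ∩ C) = ∅ := by rw [← inter_assoc, h0, empty_inter]
    have h2 : X ∩ {p | X ∩ B ⊆ {p} ∧ p ∈ C} = X ∩ (C \ B) := by
      ext x
      have h3 : ¬ (x ∈ X ∧ x ∈ B) := eq_empty_iff_forall_notMem.1 h0 x
      simp only [h0, mem_inter_iff, mem_ofPred_eq, empty_subset, true_and, mem_sdiff]
      tauto
    rw [h0, h1] at *
    rw [h2]
    simp
  · rw [if_neg (by simpa using h0), mul_zero, zero_add]
    by_cases h1 : ∃ a ∈ C, X ∩ B = {a}
    · obtain ⟨a, ha, h⟩ := h1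
      have haX : a ∈ X ∩ B := by rw [h]; rfl
      have h2 : X ∩ {p | X ∩ B ⊆ {p} ∧ p ∈ C} = {a} := by
        ext x
        simp only [h, mem_inter_iff, mem_ofPred_eq, singleton_subset_iff, mem_singleton_iff]
        constructor
        · exact fun hx => hx.2.1.symm
        · rintro rfl
          exact ⟨haX.1, rfl, ha⟩
      rw [h2, if_pos]
      · simp
      · constructor
        · exact encard_eq_one.2 ⟨a, by rw [← inter_assoc, h]; simpa using ha⟩
        · rw [encard_eq_zero, ← inter_sdiff_assoc, h, sdiff_eq_empty]; simpa using ha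
    · rw [if_neg]
      · have h2 : X ∩ {p | X ∩ B ⊆ {p} ∧ p ∈ C} = ∅ := by
          refine eq_empty_iff_forall_notMem.2 fun x hx => h1 ⟨x, hx.2.2, ?_⟩
          exact (subset_singleton_iff_eq.1 hx.2.1).resolve_left h0
        rw [h2, encard_empty, ENat.toENNReal_zero]
      · rw [encard_eq_one, encard_eq_zero]
        rintro ⟨⟨a, ha⟩, h⟩
        have haX : a ∈ X ∩ (B ∩ C) := by rw [ha]; rfl
        refine h1 ⟨a, haX.2.2, ?_⟩
        rw [← inter_union_sdiff B C, inter_union_distrib_left, ha, h, union_empty]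

theorem Config.tsum_void_erase {Y : Type*} {W : ℝ → Set Y} (ξ : Config W) (B C : Set Y) :
    ∑' p : ξ.1, ({η : Config W | η.1 ∩ B = ∅} ×ˢ C).indicator (1 : Config W × Y → ENNReal)
      (ξ.erase p, (p : Y)) =
    (ξ.count (C \ B) : ENNReal) * (if ξ.count B = 0 then 1 else 0) +
      if ξ.count (B ∩ C) = 1 ∧ ξ.count (B \ C) = 0 then 1 else 0 := by
  have hmem : ∀ p, (ξ.erase p, p) ∈ {η : Config W | η.1 ∩ B = ∅} ×ˢ C ↔
      ξ.1 ∩ B ⊆ {p} ∧ p ∈ C := by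
    intro p
    simp only [erase, mem_prod, eq_empty_iff_forall_notMem, subset_def]
    refine and_congr_left fun _ => forall_congr' fun x => ?_
    simp only [mem_inter_iff, mem_sdiff, mem_singleton_iff]
    tauto
  have hterm : ∀ p : Y, ({η : Config W | η.1 ∩ B = ∅} ×ˢ C).indicator
      (1 : Config W × Y → ENNReal) (ξ.erase p, p) =
      {p | ξ.1 ∩ B ⊆ {p} ∧ p ∈ C}.indicator 1 p := fun p => by
    by_cases h : ξ.1 ∩ B ⊆ {p} ∧ p ∈ C
    · rw [indicator_of_mem ((hmem p).2 h)]
      exact (indicator_of_mem (s := {p | ξ.1 ∩ B ⊆ {p} ∧ p ∈ C}) h 1).symm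
    · rw [indicator_of_notMem (mt (hmem p).1 h)]
      exact (indicator_of_notMem (s := {p | ξ.1 ∩ B ⊆ {p} ∧ p ∈ C}) h 1).symm
  simp_rw [hterm]
  rw [tsum_indicator]
  exact encard_inter_subset_singleton ξ.1 B C

theorem lintegral_poissonMeasure_id (r : NNReal) :
    ∫⁻ n : ℕ, (n : ENNReal) ∂poissonMeasure r = r := by
  rw [lintegral_countable']
  simp_rw [poissonMeasure_singleton]
  rw [tsum_eq_zero_add' ENNReal.summable]
  have h : ∀ n : ℕ, ((n + 1 : ℕ) : ENNReal) *
      ENNReal.ofReal (Real.exp (-r) * r ^ (n + 1) / (n + 1).factorial) =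
      r * poissonMeasure r {n} := by
    intro n
    rw [poissonMeasure_singleton, ← ENNReal.ofReal_natCast, ← ENNReal.ofReal_coe_nnreal,
      ← ENNReal.ofReal_mul (by positivity), ← ENNReal.ofReal_mul (by positivity)]
    congr 1
    rw [Nat.factorial_succ]
    push_cast
    field_simp
    ring
  simp_rw [h, ENNReal.tsum_mul_left]
  have := lintegral_countable' (μ := poissonMeasure r) (fun _ => 1)
  simp only [lintegral_const, measure_univ, one_mul] at this
  rw [← this]
  simp

namespace IsPoissonProcess

variable {Ω : Type*} [MeasurableSpace Ω] {α : Measure Vertex} {P : Measure Ω}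
  {Ξ : Ω → VertexConfig}

theorem measurable_count (hΞ : IsPoissonProcess α P Ξ) {B : Set Vertex} (hB : MeasurableSet B) :
    Measurable fun ω => (Ξ ω).count B :=
  (Config.measurable_count hB).comp hΞ.measurable

theorem measure_count_eq (hΞ : IsPoissonProcess α P Ξ) {B : Set Vertex} (hB : MeasurableSet B)
    (h : α B ≠ ⊤) (k : ℕ) : P {ω | (Ξ ω).count B = k} =
      ENNReal.ofReal (Real.exp (-(α B).toReal) * (α B).toReal ^ k / k.factorial) := by
  have h1 := congrArg (fun μ => μ {(k : ℕ∞)}) (hΞ.count_law B hB h)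
  rw [Measure.map_apply (hΞ.measurable_count hB) (measurableSet_singleton _),
    Measure.map_apply Measurable.of_discrete (measurableSet_singleton _)] at h1
  have h2 : (fun n : ℕ => (n : ℕ∞)) ⁻¹' {(k : ℕ∞)} = {k} := by ext; simp
  rw [h2, poissonMeasure_singleton] at h1
  exact h1

theorem lintegral_count (hΞ : IsPoissonProcess α P Ξ) {B : Set Vertex} (hB : MeasurableSet B)
    (h : α B ≠ ⊤) : ∫⁻ ω, ((Ξ ω).count B : ENNReal) ∂P = α B := by
  have h1 : ∫⁻ ω, ((Ξ ω).count B : ENNReal) ∂P =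
      ∫⁻ n, (n : ENNReal) ∂(P.map fun ω => (Ξ ω).count B) :=
    (lintegral_map Measurable.of_discrete (hΞ.measurable_count hB)).symm
  rw [h1, hΞ.count_law B hB h, lintegral_map Measurable.of_discrete Measurable.of_discrete]
  simpa [ENNReal.coe_toNNReal h] using lintegral_poissonMeasure_id (α B).toNNReal

theorem indepFun (hΞ : IsPoissonProcess α P Ξ) {B C : Set Vertex} (hB : MeasurableSet B)
    (hC : MeasurableSet C) (h : Disjoint B C) :
    IndepFun (fun ω => (Ξ ω).count B) (fun ω => (Ξ ω).count C) P := by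
  refine (hΞ.indep 2 ![B, C] ?_ ?_).indepFun (i := 0) (j := 1) (by simp)
  · intro i
    fin_cases i
    exacts [hB, hC]
  · intro i j hij
    fin_cases i <;> fin_cases j <;> simp_all [disjoint_comm]

theorem measure_mem_eq_zero (hΞ : IsPoissonProcess α P Ξ) {p : Vertex} (hp : α {p} = 0) :
    ∀ᵐ ω ∂P, p ∉ (Ξ ω).1 := by
  have h := hΞ.lintegral_count (measurableSet_singleton p) (by simp [hp])
  rw [hp] at h
  filter_upwards [(lintegral_eq_zero_iff ((Measurable.of_discrete
    (f := fun n : ℕ∞ => (n : ENNReal))).comp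
    (hΞ.measurable_count (measurableSet_singleton p)))).1 h] with ω hω hpω
  have : (Ξ ω).1 ∩ {p} = ∅ := by simpa [Config.count] using hω
  exact eq_empty_iff_forall_notMem.1 this p ⟨hpω, rfl⟩

/-- Counts in disjoint sets are independent, so the two cases of `Config.tsum_void_erase` contribute
`α (C \ B) * exp (-α B)` and `α (B ∩ C) * exp (-α (B ∩ C)) * exp (-α (B \ C))`. They add up to `α C
* exp (-α B)`. -/
theorem lintegral_void_erase (hΞ : IsPoissonProcess α P Ξ) {B C : Set Vertex}
    (hB : MeasurableSet B) (hB' : α B ≠ ⊤) (hC : MeasurableSet C) (hC' : α C ≠ ⊤) :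
    ∫⁻ ω, ∑' p : (Ξ ω).1, ({η : VertexConfig | η.1 ∩ B = ∅} ×ˢ C).indicator
      (1 : VertexConfig × Vertex → ENNReal) ((Ξ ω).erase p, (p : Vertex)) ∂P =
    P {ω | (Ξ ω).1 ∩ B = ∅} * α C := by
  have hfin : ∀ {D E : Set Vertex}, D ⊆ E → α E ≠ ⊤ → α D ≠ ⊤ := fun h h' =>
    ((measure_mono h).trans_lt h'.lt_top).ne
  simp_rw [Config.tsum_void_erase]
  have hBC := hB.inter hC
  have hB_C := hB.diff hC
  have hC_B := hC.diff hB
  have hvoid : P {ω | (Ξ ω).1 ∩ B = ∅} = ENNReal.ofReal (Real.exp (-(α B).toReal)) := by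
    simpa [Config.count] using hΞ.measure_count_eq hB hB' 0
  have hm : MeasurableSet {ω | (Ξ ω).count (B ∩ C) = 1 ∧ (Ξ ω).count (B \ C) = 0} :=
    (hΞ.measurable_count hBC (measurableSet_singleton 1)).inter
      (hΞ.measurable_count hB_C (measurableSet_singleton 0))
  have h1 : ∫⁻ ω, ((Ξ ω).count (C \ B) : ENNReal) * (if (Ξ ω).count B = 0 then 1 else 0) ∂P =
      α (C \ B) * P {ω | (Ξ ω).1 ∩ B = ∅} := by
    have hi := (hΞ.indepFun hC_B hB disjoint_sdiff_left).comp
      (φ := fun n : ℕ∞ => (n : ENNReal)) (ψ := fun n : ℕ∞ => if n = 0 then (1 : ENNReal) else 0)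
      Measurable.of_discrete Measurable.of_discrete
    have := lintegral_mul_eq_lintegral_mul_lintegral_of_indepFun''
      (Measurable.of_discrete.comp (hΞ.measurable_count hC_B)).aemeasurable
      (Measurable.of_discrete.comp (hΞ.measurable_count hB)).aemeasurable hi
    simp only [Function.comp_apply] at this
    rw [this, hΞ.lintegral_count hC_B (hfin sdiff_subset hC')]
    congr 1
    have hs : MeasurableSet {ω | (Ξ ω).count B = 0} :=
      hΞ.measurable_count hB (measurableSet_singleton 0)
    have he : {ω | (Ξ ω).1 ∩ B = ∅} = {ω | (Ξ ω).count B = 0} := by simp [Config.count]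
    rw [he, ← lintegral_indicator_one hs]
    exact lintegral_congr fun ω => by simp [indicator_apply]
  have h2 : ∫⁻ ω, (if (Ξ ω).count (B ∩ C) = 1 ∧ (Ξ ω).count (B \ C) = 0 then 1 else 0) ∂P =
      α (B ∩ C) * P {ω | (Ξ ω).1 ∩ B = ∅} := by
    have : ∫⁻ ω, (if (Ξ ω).count (B ∩ C) = 1 ∧ (Ξ ω).count (B \ C) = 0 then 1 else 0) ∂P =
        P {ω | (Ξ ω).count (B ∩ C) = 1 ∧ (Ξ ω).count (B \ C) = 0} := by
      rw [← lintegral_indicator_one hm]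
      exact lintegral_congr fun ω => by simp [indicator_apply]
    rw [this]
    have hd : Disjoint (B ∩ C) (B \ C) := disjoint_sdiff_right.mono_left inter_subset_right
    refine ((hΞ.indepFun hBC hB_C hd).measure_inter_preimage_eq_mul {1} {0}
      (measurableSet_singleton _) (measurableSet_singleton _)).trans ?_
    have e1 := hΞ.measure_count_eq hBC (hfin inter_subset_left hB') 1
    have e0 := hΞ.measure_count_eq hB_C (hfin sdiff_subset hB') 0
    refine (congrArg₂ (· * ·) e1 e0).trans ?_
    rw [hvoid]
    conv_rhs => rw [← ENNReal.ofReal_toReal (hfin inter_subset_left hB' : α (B ∩ C) ≠ ⊤)]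
    have hadd : (α B).toReal = (α (B ∩ C)).toReal + (α (B \ C)).toReal := by
      rw [← measure_inter_add_sdiff B hC, ENNReal.toReal_add (hfin inter_subset_left hB')
        (hfin sdiff_subset hB')]
    rw [← ENNReal.ofReal_mul (by positivity), ← ENNReal.ofReal_mul (by positivity), hadd, neg_add,
      Real.exp_add]
    congr 1
    simp
    ring
  rw [lintegral_add_right _ (Measurable.ite hm measurable_const measurable_const), h1, h2,
    ← add_mul, mul_comm, inter_comm, ← measure_inter_add_sdiff C hB, add_comm]

/-- The **Mecke formula**. -/
theorem mecke [IsProbabilityMeasure P] (hΞ : IsPoissonProcess α P Ξ)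
    (hα : ∀ t, α (bornBy t) < ⊤) {g : VertexConfig × Vertex → ENNReal} (hg : Measurable g) :
    ∫⁻ ω, ∑' p : (Ξ ω).1, g ((Ξ ω).erase p, (p : Vertex)) ∂P =
      ∫⁻ p, ∫⁻ ω, g (Ξ ω, p) ∂P ∂α := by
  let K : Ω → Measure (VertexConfig × Vertex) := fun ω =>
    Measure.sum fun p : (Ξ ω).1 => Measure.dirac ((Ξ ω).erase p, (p : Vertex))
  have hK : ∀ ω {k : VertexConfig × Vertex → ENNReal}, Measurable k →
      ∫⁻ x, k x ∂K ω = ∑' p : (Ξ ω).1, k ((Ξ ω).erase p, (p : Vertex)) := by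
    intro ω k hk
    rw [lintegral_sum_measure]
    simp_rw [lintegral_dirac' _ hk]
  have hKm : Measurable K := by
    refine Measure.measurable_of_measurable_coe _ fun S hS => ?_
    simp_rw [← lintegral_indicator_one hS, hK _ (measurable_one.indicator hS)]
    exact Config.measurable_tsum hΞ.measurable
      (g := fun ω p => S.indicator 1 ((Ξ ω).erase p, p))
      ((measurable_one.indicator hS).comp ((Config.measurable_erase
        (hΞ.measurable.comp measurable_fst) measurable_snd).prodMk measurable_snd))
  have hbdd : ∀ {B : Set Vertex}, (∃ n : ℕ, B ⊆ bornBy n) → α B ≠ ⊤ := by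
    rintro B ⟨n, hn⟩
    exact ((measure_mono hn).trans_lt (hα n)).ne
  have hspan : α.FiniteSpanningSetsIn
      {B : Set Vertex | MeasurableSet B ∧ ∃ n : ℕ, B ⊆ bornBy n} :=
    { set := fun n => bornBy n
      set_mem := fun n => ⟨measurableSet_bornBy n, n, subset_rfl⟩
      finite := fun n => hα n
      spanning := iUnion_eq_univ_iff.2 (Exhausting.exists_nat_mem bornBy) }
  have : SigmaFinite α := hspan.sigmaFinite
  have : IsProbabilityMeasure (P.map Ξ) := Measure.isProbabilityMeasure_map hΞ.measurable.aemeasurable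
  -- The mean of `K` is the reduced Campbell measure of `Ξ`. It is compared with the product measure
  -- on void events times bounded sets.
  have key : (P.map Ξ).prod α = P.bind K := by
    refine Measure.prod_eq_generateFrom Config.generateFrom_void (C := _)
      (D := {B : Set Vertex | MeasurableSet B ∧ ∃ n : ℕ, B ⊆ bornBy n}) ?_ ?_ ?_ ?_ hspan ?_
    · refine le_antisymm (MeasurableSpace.generateFrom_le fun B hB => hB.1) fun B hB => ?_
      have : B = ⋃ n : ℕ, B ∩ bornBy n := by
        rw [← inter_iUnion, iUnion_eq_univ_iff.2 (Exhausting.exists_nat_mem bornBy), inter_univ]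
      rw [this]
      refine @MeasurableSet.iUnion _ _ (_) _ _ fun n => ?_
      exact MeasurableSpace.measurableSet_generateFrom
        ⟨hB.inter (measurableSet_bornBy n), n, inter_subset_right⟩
    · rintro _ ⟨B, hB, ⟨n, hn⟩, rfl⟩ _ ⟨C, hC, ⟨m, hm⟩, rfl⟩ -
      refine ⟨B ∪ C, hB.union hC, ⟨max n m, union_subset
        (hn.trans (Exhausting.mono (Nat.cast_le.2 (le_max_left n m))))
        (hm.trans (Exhausting.mono (Nat.cast_le.2 (le_max_right n m))))⟩, ?_⟩
      ext ξ
      simp [inter_union_distrib_left, union_empty_iff]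
    · rintro B ⟨hB, n, hn⟩ C ⟨hC, -⟩ -
      exact ⟨hB.inter hC, n, inter_subset_left.trans hn⟩
    · exact
      { set := fun _ => univ
        -- Every configuration avoids the empty set, so the whole space is itself a void event.
        set_mem := fun _ => ⟨∅, MeasurableSet.empty, ⟨0, empty_subset _⟩, by simp⟩
        finite := fun _ => measure_lt_top _ _
        spanning := iUnion_const _ }
    · rintro _ ⟨B, hB, hB', rfl⟩ C ⟨hC, hC'⟩
      have hS := (Config.measurableSet_void (W := bornBy) hB).prod hC
      rw [Measure.bind_apply hS hKm.aemeasurable]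
      simp_rw [← lintegral_indicator_one hS, hK _ (measurable_one.indicator hS)]
      rw [hΞ.lintegral_void_erase hB (hbdd hB') hC (hbdd hC'),
        Measure.map_apply hΞ.measurable (Config.measurableSet_void hB)]
      rfl
  have h1 : ∫⁻ ω, ∑' p : (Ξ ω).1, g ((Ξ ω).erase p, (p : Vertex)) ∂P = ∫⁻ x, g x ∂(P.bind K) := by
    rw [Measure.lintegral_bind hKm.aemeasurable hg.aemeasurable]
    simp_rw [hK _ hg]
  rw [h1, ← key, lintegral_prod_symm _ hg.aemeasurable]
  refine lintegral_congr fun p => ?_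
  exact lintegral_map (hg.comp measurable_prodMk_right) hΞ.measurable

end IsPoissonProcess

/-! ### Splitting and reindexing independent marks -/

section InfinitePi

variable {ι κ X E : Type*} [MeasurableSpace X] [MeasurableSpace E] (ν : Measure X)
  [IsProbabilityMeasure ν]

/-- A cylinder set splits into its constraints on the indices in `A` and on the others, so its
probability factorises. This allows the marks outside `A` to be replaced by an independent copy. -/
theorem infinitePi_map_glue (A : Set ι) [DecidablePred (· ∈ A)] :
    ((Measure.infinitePi fun _ : ι => ν).prod (Measure.infinitePi fun _ : ι => ν)).map
      (fun x i => if i ∈ A then x.1 i else x.2 i) = Measure.infinitePi fun _ : ι => ν := by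
  refine Measure.eq_infinitePi _ fun s t ht => ?_
  have hm : Measurable fun (x : (ι → X) × (ι → X)) i => if i ∈ A then x.1 i else x.2 i := by
    refine measurable_pi_lambda _ fun i => ?_
    split_ifs
    · exact (measurable_pi_apply i).comp measurable_fst
    · exact (measurable_pi_apply i).comp measurable_snd
  rw [Measure.map_apply hm (MeasurableSet.pi s.countable_toSet fun i _ => ht i)]
  have : (fun (x : (ι → X) × (ι → X)) i => if i ∈ A then x.1 i else x.2 i) ⁻¹' (s : Set ι).pi t =
      ((s.filter (· ∈ A) : Finset ι) : Set ι).pi t ×ˢ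
        ((s.filter (· ∉ A) : Finset ι) : Set ι).pi t := by
    ext x
    simp only [mem_preimage, Set.mem_pi, mem_prod, Finset.coe_filter, mem_ofPred_eq,
      Finset.mem_coe]
    constructor
    · exact fun h => ⟨fun i hi => by simpa [hi.2] using h i hi.1,
        fun i hi => by simpa [hi.2] using h i hi.1⟩
    · rintro ⟨h1, h2⟩ i hi
      split_ifs with hA
      · exact h1 i ⟨hi, hA⟩
      · exact h2 i ⟨hi, hA⟩
  rw [this, Measure.prod_prod, Measure.infinitePi_pi _ fun i _ => ht i,
    Measure.infinitePi_pi _ fun i _ => ht i, Finset.prod_filter_mul_prod_filter_not]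

/-- A functional of independent marks which depends only on the marks in `s` may be computed from
independent marks with another index set. -/
theorem measurable_and_map_infinitePi_eq {F : (ι → X) → E} {s : Set ι} {ρ : ι → κ}
    (hρ : InjOn ρ s) (hF : ∀ u v, (∀ i ∈ s, u i = v i) → F u = F v)
    (hm : Measurable fun U : κ → X => F fun i => U (ρ i)) :
    Measurable F ∧ (Measure.infinitePi fun _ : ι => ν).map F =
      (Measure.infinitePi fun _ : κ => ν).map fun U => F fun i => U (ρ i) := by
  classical
  have hX : Nonempty X := nonempty_of_isProbabilityMeasure ν
  let x₀ : X := hX.some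
  -- A measurable right inverse on the marks in `s`: since `ρ` is injective there, the chosen index
  -- for `ρ i` is `i`. The value `x₀` off the image of `s` is never read by `F`.
  let ext : (ι → X) → κ → X := fun u k => if h : ∃ i ∈ s, ρ i = k then u h.choose else x₀
  have hext : Measurable ext := by
    refine measurable_pi_lambda _ fun k => ?_
    by_cases h : ∃ i ∈ s, ρ i = k
    · simp only [ext, dif_pos h]
      exact measurable_pi_apply _
    · simp only [ext, dif_neg h]
      exact measurable_const
  have hFm : Measurable F := by
    convert hm.comp hext using 1
    ext u
    refine hF _ _ fun i hi => ?_
    have h : ∃ j ∈ s, ρ j = ρ i := ⟨i, hi, rfl⟩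
    simp only [ext, dif_pos h]
    rw [hρ h.choose_spec.1 hi h.choose_spec.2]
  refine ⟨hFm, ?_⟩
  -- Both laws are images under `F'` of the product law on `s`.
  let F' : (s → X) → E := fun w => F fun i => if h : i ∈ s then w ⟨i, h⟩ else x₀
  have hF' : Measurable F' := by
    refine hFm.comp (measurable_pi_lambda _ fun i => ?_)
    by_cases h : i ∈ s
    · simp only [dif_pos h]
      exact measurable_pi_apply _
    · simp only [dif_neg h]
      exact measurable_const
  have h1 : F = F' ∘ fun u (i : s) => u i := by
    ext u
    exact hF _ _ fun i hi => by simp [hi]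
  have h2 : (fun U : κ → X => F fun i => U (ρ i)) = F' ∘ fun U (i : s) => U (ρ i) := by
    ext U
    exact hF _ _ fun i hi => by simp [hi]
  rw [h2, h1, ← Measure.map_map hF' (by fun_prop), ← Measure.map_map hF' (by fun_prop),
    Measure.map_infinitePi_infinitePi_of_inj Subtype.val_injective]
  exact congrArg _ (Measure.map_infinitePi_infinitePi_of_inj (P := fun _ : κ => ν)
    (f := fun i : s => ρ i) hρ.injective).symm

end InfinitePi

/-! ### Which vertices and marks the edges depend on -/

section Construction

variable {φ : ℝ → ℝ} {f : ℕ → ℝ} {ξ ξ' : VertexConfig} {u v : Marks} {p q r : Vertex}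

theorem mem_targets_iff : p ∈ targets φ f ξ u q ↔ p ∈ ξ.1 ∧ birth p < birth q ∧
    (u (q, p) : ℝ) < connProb φ f q p
      (ξ.1 ∩ {r | birth r < birth q ∧ p ∈ targets φ f ξ u r}).ncard := by
  have h : {r | ∃ _ : r ∈ ξ.1 ∧ birth r < birth q, p ∈ targets φ f ξ u r} =
      ξ.1 ∩ {r | birth r < birth q ∧ p ∈ targets φ f ξ u r} := by
    ext r
    exact ⟨fun ⟨h, h'⟩ => ⟨h.1, h.2, h'⟩, fun h => ⟨⟨h.1, h.2.1⟩, h.2.2⟩⟩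
  rw [targets, ← h]
  rfl

/-- Whether the vertex `q` is connected to `p` at its birth depends only on the vertices that are
born before, and on their marks for `p`. -/
theorem mem_targets_congr (hξ : ∀ r, birth r < birth q → (r ∈ ξ.1 ↔ r ∈ ξ'.1))
    (hq : u (q, p) = v (q, p)) (hu : ∀ r ∈ ξ.1, birth r < birth q → u (r, p) = v (r, p)) :
    p ∈ targets φ f ξ u q ↔ p ∈ targets φ f ξ' v q := by
  induction hn : (ξ.1 ∩ bornBefore (birth q)).ncard using Nat.strong_induction_on generalizing q with
  | _ n ih =>
    subst hn
    have h : ξ.1 ∩ {r | birth r < birth q ∧ p ∈ targets φ f ξ u r} =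
        ξ'.1 ∩ {r | birth r < birth q ∧ p ∈ targets φ f ξ' v r} := by
      ext r
      simp only [mem_inter_iff, mem_ofPred_eq]
      constructor
      · rintro ⟨h1, h2, h3⟩
        exact ⟨(hξ r h2).1 h1, h2, (ih _ (card_older_lt h1 h2)
          (fun r' h => hξ r' (h.trans h2)) (hu r h1 h2)
          (fun r' h h' => hu r' h (h'.trans h2)) rfl).1 h3⟩
      · rintro ⟨h1, h2, h3⟩
        have h1 := (hξ r h2).2 h1
        exact ⟨h1, h2, (ih _ (card_older_lt h1 h2)
          (fun r' h => hξ r' (h.trans h2)) (hu r h1 h2)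
          (fun r' h h' => hu r' h (h'.trans h2)) rfl).2 h3⟩
    rw [mem_targets_iff, mem_targets_iff, h, hq]
    constructor
    · rintro ⟨h1, h2, h3⟩
      exact ⟨(hξ p h2).1 h1, h2, h3⟩
    · rintro ⟨h1, h2, h3⟩
      exact ⟨(hξ p h2).2 h1, h2, h3⟩

theorem mem_graphOf {e : Edge} : e ∈ (graphOf φ f ξ u).1 ↔
    ∃ q p, q ∈ ξ.1 ∧ p ∈ targets φ f ξ u q ∧ e.1 = s(q, p) := Iff.rfl

theorem mem_graphOf_of_lt {e : Edge} (he : e.1 = s(q, p)) (h : birth p < birth q) :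
    e ∈ (graphOf φ f ξ u).1 ↔ q ∈ ξ.1 ∧ p ∈ targets φ f ξ u q := by
  constructor
  · rintro ⟨q', p', hq, hp, he'⟩
    rw [he, Sym2.eq_iff] at he'
    rcases he' with ⟨rfl, rfl⟩ | ⟨rfl, rfl⟩
    · exact ⟨hq, hp⟩
    · exact absurd (mem_targets_iff.1 hp).2.1 h.le.not_gt
  · rintro ⟨hq, hp⟩
    exact ⟨q, p, hq, hp, he⟩

theorem graphOf_congr (h : ∀ q ∈ ξ.1, ∀ p ∈ ξ.1, u (q, p) = v (q, p)) :
    graphOf φ f ξ u = graphOf φ f ξ v := by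
  refine Subtype.ext (Set.ext fun e => ?_)
  rw [mem_graphOf, mem_graphOf]
  refine exists_congr fun q => exists_congr fun p => and_congr_right fun hq =>
    and_congr_left fun _ => ?_
  by_cases hp : p ∈ ξ.1
  · exact mem_targets_congr (fun _ _ => Iff.rfl) (h q hq p hp) fun r hr _ => h r hr p hp
  · exact iff_of_false (fun h => hp (mem_targets_iff.1 h).1) fun h => hp (mem_targets_iff.1 h).1

theorem outgoingOf_congr {σ : EdgeConfig} (h : ∀ y ∈ ξ.1, u (p, y) = v (p, y)) :
    outgoingOf φ f ξ σ p u = outgoingOf φ f ξ σ p v := by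
  refine Subtype.ext (Set.ext fun e => ?_)
  refine exists_congr fun y => and_congr_right fun hy => and_congr_right fun _ =>
    and_congr_left fun _ => ?_
  rw [h y hy]

/-- The edges between `p` and younger vertices depend only on the marks of these vertices
for `p`. -/
theorem incoming_congr (h : ∀ q ∈ ξ.1, u (q, p) = v (q, p)) :
    (graphOf φ f ξ u).restrict (pairsWith (bornBy (birth p))ᶜ p) =
      (graphOf φ f ξ v).restrict (pairsWith (bornBy (birth p))ᶜ p) := by
  refine Subtype.ext (Set.ext fun e => and_congr_left ?_)
  rintro ⟨y, hy, he⟩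
  have hy : birth p < birth y := not_le.1 hy
  rw [mem_graphOf_of_lt he hy, mem_graphOf_of_lt he hy]
  exact and_congr_right fun hy' =>
    mem_targets_congr (fun _ _ => Iff.rfl) (h y hy') fun r hr _ => h r hr

theorem mem_add_iff {r : Vertex} : r ∈ (ξ.add p).1 ↔ r = p ∨ r ∈ ξ.1 := Iff.rfl

/-- The indegrees just before the birth of `p` are not affected by `p`. -/
theorem inDeg_graphOf_add (y : Vertex) :
    inDeg (graphOf φ f (ξ.add p) u) y (birth p) =
      inDeg ((graphOf φ f ξ u).restrict (pairsIn (bornBefore (birth p)))) y (birth p) := by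
  unfold inDeg
  congr 1
  ext r
  refine and_congr_right fun h1 => and_congr_right fun h2 => exists_congr fun e =>
    and_congr_left fun he => ?_
  have hmem : e ∈ pairsIn (bornBefore (birth p)) := by
    intro z hz
    rw [he] at hz
    rcases Sym2.mem_iff.1 hz with rfl | rfl
    · exact h2
    · exact h1.trans h2
  have hadd : ∀ r, birth r < birth p → (r ∈ (ξ.add p).1 ↔ r ∈ ξ.1) := fun r hr =>
    mem_add_iff.trans (or_iff_right (by rintro rfl; exact lt_irrefl _ hr))
  have hiff : e ∈ ((graphOf φ f ξ u).restrict (pairsIn (bornBefore (birth p)))).1 ↔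
      e ∈ (graphOf φ f ξ u).1 := and_iff_left hmem
  rw [hiff, mem_graphOf_of_lt he h1, mem_graphOf_of_lt he h1, hadd r h2]
  exact and_congr_right fun _ =>
    mem_targets_congr (fun r' hr' => hadd r' (hr'.trans h2)) rfl fun _ _ _ => rfl

/-- The edges of a vertex `p` that is added to `ξ` are the edges that it sends, at its birth, to
older vertices, and the edges from younger vertices. -/
theorem restrict_graphOf_add (hp : p ∉ ξ.1) :
    (graphOf φ f (ξ.add p) u).restrict (pairsWith ξ.1 p) =
      (outgoingOf φ f (ξ.restrict (bornBefore (birth p)))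
        ((graphOf φ f ξ u).restrict (pairsIn (bornBefore (birth p)))) p u).union
      ((graphOf φ f (ξ.add p) u).restrict (pairsWith (bornBy (birth p))ᶜ p)) := by
  refine Subtype.ext (Set.ext fun e => ?_)
  change (e ∈ (graphOf φ f (ξ.add p) u).1 ∧ e ∈ pairsWith ξ.1 p) ↔
    (∃ y ∈ ξ.1 ∩ bornBefore (birth p), birth y < birth p ∧ (u (p, y) : ℝ) < connProb φ f p y
      (inDeg ((graphOf φ f ξ u).restrict (pairsIn (bornBefore (birth p)))) y (birth p)) ∧
      e.1 = s(p, y)) ∨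
    (e ∈ (graphOf φ f (ξ.add p) u).1 ∧ e ∈ pairsWith (bornBy (birth p))ᶜ p)
  constructor
  · rintro ⟨h1, y, hy, he⟩
    rcases le_or_gt (birth y) (birth p) with hyp | hyp
    -- The case of equal birth times is harmless: every edge of the graph joins vertices with
    -- different birth times.
    · left
      obtain ⟨q, p', hq, hp', hlt, hmark, he'⟩ := (mem_graphOf_iff φ f _ u e).1 h1
      rw [he, Sym2.eq_iff] at he'
      rcases he' with ⟨rfl, rfl⟩ | ⟨rfl, rfl⟩
      · exact absurd hlt hyp.not_gt
      · rw [inDeg_graphOf_add] at hmark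
        exact ⟨y, ⟨hy, hlt⟩, hlt, hmark, he.trans Sym2.eq_swap⟩
    · exact Or.inr ⟨h1, y, not_le.2 hyp, he⟩
  · rintro (⟨y, ⟨hy, -⟩, hlt, hmark, he⟩ | ⟨h1, y, hy, he⟩)
    · refine ⟨(mem_graphOf_iff φ f _ u e).2 ⟨p, y, Or.inl rfl, Or.inr hy, hlt, ?_, he⟩,
        y, hy, he.trans Sym2.eq_swap⟩
      rwa [inDeg_graphOf_add]
    · refine ⟨h1, y, ?_, he⟩
      have hy : birth p < birth y := not_le.1 hy
      refine ((mem_graphOf_of_lt he hy).1 h1).1.resolve_left ?_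
      rintro rfl
      exact lt_irrefl _ hy

end Construction

/-! ### Ranks of vertices -/

/-- The representative in `(0, 1]` of the position of a vertex. -/
noncomputable def position (p : Vertex) : ℝ := AddCircle.measurableEquivIoc 1 0 p.1

theorem measurable_position : Measurable position :=
  measurable_subtype_coe.comp ((AddCircle.measurableEquivIoc 1 0).measurable.comp measurable_fst)

/-- The lexicographic order of birth times and positions. -/
def Precedes (p q : Vertex) : Prop :=
  birth p < birth q ∨ birth p = birth q ∧ position p < position q

theorem Precedes.trans {p q r : Vertex} (h : Precedes p q) (h' : Precedes q r) : Precedes p r := by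
  rcases h with h | ⟨h, h1⟩ <;> rcases h' with h' | ⟨h', h2⟩
  · exact Or.inl (h.trans h')
  · exact Or.inl (h.trans_eq h')
  · exact Or.inl (h.trans_lt h')
  · exact Or.inr ⟨h.trans h', h1.trans h2⟩

theorem Precedes.irrefl (p : Vertex) : ¬ Precedes p p := by
  rintro (h | ⟨-, h⟩) <;> exact lt_irrefl _ h

theorem precedes_or_eq_or_precedes (p q : Vertex) : Precedes p q ∨ p = q ∨ Precedes q p := by
  rcases lt_trichotomy (birth p) (birth q) with h | h | h
  · exact Or.inl (Or.inl h)
  · rcases lt_trichotomy (position p) (position q) with h' | h' | h'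
    · exact Or.inl (Or.inr ⟨h, h'⟩)
    · exact Or.inr (Or.inl (Prod.ext
        ((AddCircle.measurableEquivIoc 1 0).injective (Subtype.ext h')) (Subtype.ext h)))
    · exact Or.inr (Or.inr (Or.inr ⟨h.symm, h'⟩))
  · exact Or.inr (Or.inr (Or.inl h))

theorem measurableSet_precedes : MeasurableSet {x : Vertex × Vertex | Precedes x.1 x.2} :=
  (measurableSet_lt (measurable_birth.comp measurable_fst)
    (measurable_birth.comp measurable_snd)).union
    ((measurableSet_eq_fun (measurable_birth.comp measurable_fst)
      (measurable_birth.comp measurable_snd)).inter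
      (measurableSet_lt (measurable_position.comp measurable_fst)
        (measurable_position.comp measurable_snd)))

/-- The number of vertices of `ξ` that precede `q`. -/
noncomputable def rank (ξ : VertexConfig) (q : Vertex) : ℕ := (ξ.1 ∩ {r | Precedes r q}).ncard

theorem rank_lt_rank {ξ : VertexConfig} {p q : Vertex} (hp : p ∈ ξ.1) (h : Precedes p q) :
    rank ξ p < rank ξ q := by
  refine ncard_lt_ncard ⟨fun r hr => ⟨hr.1, hr.2.trans h⟩, fun hs => ?_⟩ ?_
  · exact Precedes.irrefl p (hs ⟨hp, h⟩).2
  · refine (ξ.2 (birth q)).subset fun r hr => ⟨hr.1, ?_⟩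
    rcases hr.2 with h | h
    exacts [h.le, h.1.le]

/-- An arbitrary configuration may contain vertices with the same birth time. Breaking ties by
position makes the order total, so distinct vertices have distinct ranks. -/
theorem rank_injOn (ξ : VertexConfig) : InjOn (rank ξ) ξ.1 := by
  intro p hp q hq h
  rcases precedes_or_eq_or_precedes p q with h' | h' | h'
  · exact absurd h (rank_lt_rank hp h').ne
  · exact h'
  · exact absurd h (rank_lt_rank hq h').ne'

/-! ### Measurability of the construction -/

section Measurable

variable {A : Type*} [MeasurableSpace A] {φ : ℝ → ℝ} {f : ℕ → ℝ} {ξ : A → VertexConfig}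
  {u : A → Marks}

theorem measurable_rank (hξ : Measurable ξ) {q : A → Vertex} (hq : Measurable q) :
    Measurable fun a => rank (ξ a) (q a) :=
  Config.measurable_ncard hξ (S := fun a => {r | Precedes r (q a)})
    (measurableSet_precedes.preimage (measurable_snd.prodMk (hq.comp measurable_fst)))

theorem measurable_connProb (hφ : Measurable φ) {q p : A → Vertex} {k : A → ℕ}
    (hq : Measurable q) (hp : Measurable p) (hk : Measurable k) :
    Measurable fun a => connProb φ f (q a) (p a) (k a) :=
  hφ.comp (((measurable_birth.comp hq).mul
    ((measurable_fst.comp hq).dist (measurable_fst.comp hp))).div (Measurable.of_discrete.comp hk))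

/-- Approximations of `targets`, which disregard the vertices that have at least `n` predecessors. -/
noncomputable def targetsApprox (φ : ℝ → ℝ) (f : ℕ → ℝ) (ξ : VertexConfig) (u : Marks) :
    ℕ → Vertex → Set Vertex
  | 0, _ => ∅
  | n + 1, q => {p | p ∈ ξ.1 ∧ birth p < birth q ∧ (u (q, p) : ℝ) < connProb φ f q p
      (ξ.1 ∩ {r | birth r < birth q ∧ p ∈ targetsApprox φ f ξ u n r}).ncard}

theorem mem_targetsApprox_iff {ξ : VertexConfig} {u : Marks} {n : ℕ} {p q : Vertex}
    (h : (ξ.1 ∩ bornBefore (birth q)).ncard < n) :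
    p ∈ targetsApprox φ f ξ u n q ↔ p ∈ targets φ f ξ u q := by
  induction n generalizing q with
  | zero => simp at h
  | succ n ih =>
    have hs : ξ.1 ∩ {r | birth r < birth q ∧ p ∈ targetsApprox φ f ξ u n r} =
        ξ.1 ∩ {r | birth r < birth q ∧ p ∈ targets φ f ξ u r} := by
      ext r
      refine and_congr_right fun h1 => and_congr_right fun h2 => ih ?_
      exact (card_older_lt h1 h2).trans_le (Nat.lt_succ_iff.1 h)
    rw [mem_targets_iff, ← hs]
    rfl

/-- The approximations become constant beyond a level that depends on `ξ` and `q`. Writing this as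
an eventual statement leaves only countable unions and intersections. -/
theorem mem_targets_iff_exists_forall {ξ : VertexConfig} {u : Marks} {p q : Vertex} :
    p ∈ targets φ f ξ u q ↔ ∃ N, ∀ n ≥ N, p ∈ targetsApprox φ f ξ u n q := by
  constructor
  · intro h
    exact ⟨_, fun n hn => (mem_targetsApprox_iff (Nat.lt_of_succ_le hn)).2 h⟩
  · rintro ⟨N, hN⟩
    exact (mem_targetsApprox_iff (lt_of_lt_of_le (Nat.lt_succ_self _) (le_max_right N _))).1
      (hN _ (le_max_left _ _))

theorem measurableSet_targetsApprox (hφ : Measurable φ) (hξ : Measurable ξ)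
    (hu : Measurable fun x : A × (Vertex × Vertex) => u x.1 x.2) (n : ℕ) :
    MeasurableSet {x : A × (Vertex × Vertex) |
      x.2.2 ∈ targetsApprox φ f (ξ x.1) (u x.1) n x.2.1} := by
  induction n with
  | zero => simp [targetsApprox]
  | succ n ih =>
    have h1 : Measurable fun x : A × (Vertex × Vertex) => ((ξ x.1).1 ∩
        {r | birth r < birth x.2.1 ∧ x.2.2 ∈ targetsApprox φ f (ξ x.1) (u x.1) n r}).ncard :=
      Config.measurable_ncard (hξ.comp measurable_fst) (S := fun x : A × (Vertex × Vertex) =>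
        {r | birth r < birth x.2.1 ∧ x.2.2 ∈ targetsApprox φ f (ξ x.1) (u x.1) n r})
        ((measurableSet_lt (measurable_birth.comp measurable_snd)
          (measurable_birth.comp (measurable_fst.comp (measurable_snd.comp measurable_fst)))).inter
          (ih.preimage (f := fun y : (A × (Vertex × Vertex)) × Vertex => (y.1.1, (y.2, y.1.2.2)))
            (by fun_prop)))
    have h2 : Measurable fun x : A × (Vertex × Vertex) => x.2.1 := by fun_prop
    have h3 : Measurable fun x : A × (Vertex × Vertex) => x.2.2 := by fun_prop
    exact (Config.measurableSet_mem (hξ.comp measurable_fst) h3).inter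
      ((measurableSet_lt (measurable_birth.comp h3) (measurable_birth.comp h2)).inter
        (measurableSet_lt (measurable_subtype_coe.comp hu) (measurable_connProb hφ h2 h3 h1)))

theorem measurableSet_targets (hφ : Measurable φ) (hξ : Measurable ξ)
    (hu : Measurable fun x : A × (Vertex × Vertex) => u x.1 x.2) :
    MeasurableSet {x : A × (Vertex × Vertex) | x.2.2 ∈ targets φ f (ξ x.1) (u x.1) x.2.1} := by
  simp only [mem_targets_iff_exists_forall, ofPred_exists, ofPred_forall]
  exact MeasurableSet.iUnion fun N => MeasurableSet.iInter fun n => MeasurableSet.iInter fun _ =>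
    measurableSet_targetsApprox hφ hξ hu n

theorem measurable_graphOf (hφ : Measurable φ) (hξ : Measurable ξ)
    (hu : Measurable fun x : A × (Vertex × Vertex) => u x.1 x.2) :
    Measurable fun a => graphOf φ f (ξ a) (u a) := by
  refine Config.measurable_of_void fun B hB _ => ?_
  have h2 : MeasurableSet {y : (A × Vertex) × Vertex |
      y.2 ∈ targets φ f (ξ y.1.1) (u y.1.1) y.1.2 ∧ s(y.1.2, y.2) ∈ Subtype.val '' B} :=
    ((measurableSet_targets hφ hξ hu).preimage (f := fun y : (A × Vertex) × Vertex =>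
      (y.1.1, (y.1.2, y.2))) (by fun_prop)).inter
      ((measurableSet_image_edge hB).preimage (measurable_sym2Mk.comp
        (f := fun y : (A × Vertex) × Vertex => (y.1.2, y.2)) (by fun_prop)))
  have h1 := Config.measurableSet_exists (hξ.comp measurable_fst)
    (S := fun (x : A × Vertex) p => p ∈ targets φ f (ξ x.1) (u x.1) x.2 ∧
      s(x.2, p) ∈ Subtype.val '' B) h2
  have h0 := (Config.measurableSet_exists hξ
    (S := fun a q => ∃ p ∈ (ξ a).1, p ∈ targets φ f (ξ a) (u a) q ∧
      s(q, p) ∈ Subtype.val '' B) h1).compl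
  convert h0 using 1
  ext a
  rw [mem_ofPred_eq, mem_compl_iff, ← not_nonempty_iff_eq_empty]
  refine not_congr ⟨?_, ?_⟩
  · rintro ⟨e, ⟨q, p, hq, hp, he⟩, hB⟩
    exact ⟨q, hq, p, (mem_targets_iff.1 hp).1, hp, e, hB, he⟩
  · rintro ⟨q, hq, p, -, hp, e, hB, he⟩
    exact ⟨e, ⟨q, p, hq, hp, he⟩, hB⟩

/-- The endpoints of an edge, the younger one first (and a fixed pair of vertices if the endpoints
have the same birth time). -/
noncomputable def orient : Sym2 Vertex → Vertex × Vertex :=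
  Sym2.lift ⟨fun x y => if birth y < birth x then (x, y) else if birth x < birth y then (y, x) else
    ((0, ⟨1, mem_Ioi.2 one_pos⟩), (0, ⟨1, mem_Ioi.2 one_pos⟩)), fun x y => by
      rcases lt_trichotomy (birth x) (birth y) with h | h | h
      · simp [h, h.not_gt]
      · simp [h]
      · simp [h, h.not_gt]⟩

theorem measurable_orient : Measurable orient := by
  rw [measurable_sym2_iff]
  have h1 : Measurable fun x : Vertex × Vertex => birth x.1 := measurable_birth.comp measurable_fst
  have h2 : Measurable fun x : Vertex × Vertex => birth x.2 := measurable_birth.comp measurable_snd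
  exact Measurable.ite (measurableSet_lt h2 h1) measurable_id
    (Measurable.ite (measurableSet_lt h1 h2) measurable_swap measurable_const)

theorem orient_eq_iff {e : Sym2 Vertex} {q p : Vertex} (h : birth p < birth q) :
    orient e = (q, p) ↔ e = s(q, p) := by
  constructor
  · induction e with
    | _ x y =>
      simp only [orient, Sym2.lift_mk]
      split_ifs
      · rintro ⟨⟩
        rfl
      · rintro ⟨⟩
        exact Sym2.eq_swap
      · rintro ⟨⟩
        exact absurd h (lt_irrefl _)
  · rintro rfl
    simp [orient, h]

/-- An edge with a given older endpoint is determined by its younger one. Counting edges instead of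
vertices makes the indegree a number of points of `σ` in a measurable set, to which
`Config.measurable_ncard` applies. -/
theorem inDeg_eq_ncard (σ : EdgeConfig) (p : Vertex) (t : ℝ) : inDeg σ p t =
    (σ.1 ∩ {e | (orient e.1).2 = p ∧ birth p < birth (orient e.1).1 ∧
      birth (orient e.1).1 < t}).ncard := by
  rw [← InjOn.ncard_image (f := fun e : Edge => (orient e.1).1)]
  · unfold inDeg
    congr 1
    ext q
    constructor
    · rintro ⟨h1, h2, e, he, he'⟩
      have ho := (orient_eq_iff h1).2 he'
      exact ⟨e, ⟨he, by rw [ho], by rwa [ho], by rwa [ho]⟩, congrArg Prod.fst ho⟩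
    · rintro ⟨e, ⟨he, h1, h2, h3⟩, rfl⟩
      exact ⟨h2, h3, e, he, (orient_eq_iff h2).1 (Prod.ext rfl h1)⟩
  · rintro e ⟨-, h1, h2, -⟩ e' ⟨-, h1', -, -⟩ h
    have h : (orient e.1).1 = (orient e'.1).1 := h
    refine Subtype.ext (((orient_eq_iff h2).1 (Prod.ext rfl h1)).trans
      ((orient_eq_iff h2).1 (Prod.ext h.symm h1')).symm)

theorem measurable_inDeg {σ : A → EdgeConfig} (hσ : Measurable σ) {p : A → Vertex}
    (hp : Measurable p) (t : ℝ) : Measurable fun a => inDeg (σ a) (p a) t := by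
  simp_rw [inDeg_eq_ncard]
  have ho : Measurable fun x : A × Edge => orient x.2.1 :=
    measurable_orient.comp (measurable_subtype_coe.comp measurable_snd)
  have hb := measurable_birth.comp (measurable_fst.comp ho)
  exact Config.measurable_ncard hσ
    (S := fun a => {e | (orient e.1).2 = p a ∧ birth (p a) < birth (orient e.1).1 ∧
      birth (orient e.1).1 < t})
    ((measurableSet_eq_fun (measurable_snd.comp ho) (hp.comp measurable_fst)).inter
      ((measurableSet_lt (measurable_birth.comp (hp.comp measurable_fst)) hb).inter
        (measurableSet_lt hb measurable_const)))

theorem measurable_outgoingOf (hφ : Measurable φ) (hξ : Measurable ξ) {σ : A → EdgeConfig}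
    (hσ : Measurable σ) (p : Vertex)
    (hu : Measurable fun x : A × (Vertex × Vertex) => u x.1 x.2) :
    Measurable fun a => outgoingOf φ f (ξ a) (σ a) p (u a) := by
  refine Config.measurable_of_void fun B hB _ => ?_
  have h1 : MeasurableSet {x : A × Vertex | birth x.2 < birth p ∧
      (u x.1 (p, x.2) : ℝ) < connProb φ f p x.2 (inDeg (σ x.1) x.2 (birth p)) ∧
        s(p, x.2) ∈ Subtype.val '' B} :=
    (measurableSet_lt (measurable_birth.comp measurable_snd) measurable_const).inter
      ((measurableSet_lt (measurable_subtype_coe.comp (hu.comp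
        (g := fun x : A × (Vertex × Vertex) => u x.1 x.2)
        (f := fun x : A × Vertex => (x.1, (p, x.2))) (by fun_prop)))
        (measurable_connProb hφ measurable_const measurable_snd
          (measurable_inDeg (hσ.comp measurable_fst) measurable_snd _))).inter
      ((measurableSet_image_edge hB).preimage (measurable_sym2Mk.comp
        (f := fun x : A × Vertex => (p, x.2)) (by fun_prop))))
  have h0 := (Config.measurableSet_exists hξ (S := fun a y => birth y < birth p ∧
      (u a (p, y) : ℝ) < connProb φ f p y (inDeg (σ a) y (birth p)) ∧
        s(p, y) ∈ Subtype.val '' B) h1).compl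
  convert h0 using 1
  ext a
  rw [mem_ofPred_eq, mem_compl_iff, ← not_nonempty_iff_eq_empty]
  refine not_congr ⟨?_, ?_⟩
  · rintro ⟨e, ⟨y, hy, h1, h2, he⟩, hB⟩
    exact ⟨y, hy, h1, h2, e, hB, he⟩
  · rintro ⟨y, hy, h1, h2, e, hB, he⟩
    exact ⟨e, ⟨y, hy, h1, h2, he⟩, hB⟩

end Measurable

/-! ### The conditional edge laws as kernels -/

section Kernel

variable {φ : ℝ → ℝ} {f : ℕ → ℝ}

theorem measurable_eval_countable {A ι X : Type*} [MeasurableSpace A] [Countable ι]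
    [MeasurableSpace ι] [MeasurableSingletonClass ι] [MeasurableSpace X] {U : A → ι → X}
    (hU : Measurable U) {i : A → ι} (hi : Measurable i) : Measurable fun a => U a (i a) := by
  have h : Measurable fun x : (ι → X) × ι => x.1 x.2 :=
    measurable_from_prod_countable_left fun i => measurable_pi_apply i
  exact h.comp (hU.prodMk hi)

/-- The law of independent uniform marks for pairs of ranks. -/
noncomputable def rankMarkLaw : Measure (ℕ × ℕ → unitInterval) := Measure.infinitePi fun _ => volume

instance : IsProbabilityMeasure rankMarkLaw := by unfold rankMarkLaw; infer_instance

instance : IsProbabilityMeasure markLaw := by unfold markLaw; infer_instance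

/-- The marks of pairs of vertices that are given by the marks of their ranks. -/
noncomputable def rankMarks (ξ : VertexConfig) (U : ℕ × ℕ → unitInterval) : Marks :=
  fun x => U (rank ξ x.1, rank ξ x.2)

theorem measurable_rankMarks {A : Type*} [MeasurableSpace A] {ξ : A → VertexConfig}
    (hξ : Measurable ξ) {U : A → ℕ × ℕ → unitInterval} (hU : Measurable U) :
    Measurable fun x : A × (Vertex × Vertex) => rankMarks (ξ x.1) (U x.1) x.2 :=
  measurable_eval_countable (hU.comp measurable_fst)
    ((measurable_rank (hξ.comp measurable_fst) (measurable_fst.comp measurable_snd)).prodMk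
      (measurable_rank (hξ.comp measurable_fst) (measurable_snd.comp measurable_snd)))

theorem measurable_graphOf_rankMarks (hφ : Measurable φ) :
    Measurable fun x : VertexConfig × (ℕ × ℕ → unitInterval) =>
      graphOf φ f x.1 (rankMarks x.1 x.2) :=
  measurable_graphOf hφ measurable_fst (measurable_rankMarks measurable_fst measurable_snd)

/-- The graph reads only the marks of pairs from `ξ`, and on these the pair of ranks is injective.
-/
theorem measurable_graphOf_marks_and (hφ : Measurable φ) (ξ : VertexConfig) :
    Measurable (graphOf φ f ξ) ∧
      edgeLaw φ f ξ = rankMarkLaw.map fun U => graphOf φ f ξ (rankMarks ξ U) := by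
  refine measurable_and_map_infinitePi_eq volume (s := ξ.1 ×ˢ ξ.1)
    (ρ := fun x => (rank ξ x.1, rank ξ x.2)) ?_ ?_ ?_
  · rintro ⟨x, y⟩ ⟨hx, hy⟩ ⟨x', y'⟩ ⟨hx', hy'⟩ h
    simp only [Prod.mk.injEq] at h
    exact Prod.ext (rank_injOn ξ hx hx' h.1) (rank_injOn ξ hy hy' h.2)
  · exact fun u v h => graphOf_congr fun q hq p hp => h (q, p) ⟨hq, hp⟩
  · exact (measurable_graphOf_rankMarks hφ).comp measurable_prodMk_left

theorem measurable_graphOf_marks (hφ : Measurable φ) (ξ : VertexConfig) :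
    Measurable (graphOf φ f ξ) :=
  (measurable_graphOf_marks_and hφ ξ).1

theorem measurable_map_prodMk {A B E : Type*} [MeasurableSpace A] [MeasurableSpace B]
    [MeasurableSpace E] (ν : Measure B) [SFinite ν] {F : A × B → E} (hF : Measurable F) :
    Measurable fun a => ν.map fun b => F (a, b) := by
  refine Measure.measurable_of_measurable_coe _ fun S hS => ?_
  have : ∀ a, ν.map (fun b => F (a, b)) S = ν (Prod.mk a ⁻¹' (F ⁻¹' S)) := fun a =>
    Measure.map_apply (hF.comp measurable_prodMk_left) hS
  simp_rw [this]
  exact measurable_measure_prodMk_left (hF hS)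

theorem measurable_edgeLaw (hφ : Measurable φ) : Measurable (edgeLaw φ f) := by
  have := measurable_map_prodMk rankMarkLaw (measurable_graphOf_rankMarks (f := f) hφ)
  convert this using 2 with ξ
  exact (measurable_graphOf_marks_and hφ ξ).2

theorem isProbabilityMeasure_edgeLaw (hφ : Measurable φ) (ξ : VertexConfig) :
    IsProbabilityMeasure (edgeLaw φ f ξ) :=
  Measure.isProbabilityMeasure_map (measurable_graphOf_marks hφ ξ).aemeasurable

/-- Only the marks `(p, y)` with `y` in `ξ` are read. The rank of `p` may coincide with that of a
point of `ξ`, but the first component is constant, so injectivity in `y` suffices. -/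
theorem measurable_outgoingOf_marks_and (hφ : Measurable φ) (ξ : VertexConfig) (σ : EdgeConfig)
    (p : Vertex) : Measurable (outgoingOf φ f ξ σ p) ∧ outgoingLaw φ f ξ σ p =
      rankMarkLaw.map fun U => outgoingOf φ f ξ σ p (rankMarks ξ U) := by
  refine measurable_and_map_infinitePi_eq volume (s := {p} ×ˢ ξ.1)
    (ρ := fun x => (rank ξ x.1, rank ξ x.2)) ?_ ?_ ?_
  · rintro ⟨x, y⟩ ⟨rfl, hy⟩ ⟨x', y'⟩ ⟨rfl, hy'⟩ h
    simp only [Prod.mk.injEq] at h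
    exact Prod.ext rfl (rank_injOn ξ hy hy' h.2)
  · exact fun u v h => outgoingOf_congr fun y hy => h (p, y) ⟨rfl, hy⟩
  · exact (measurable_outgoingOf hφ (ξ := fun _ => ξ)
      (σ := fun _ => σ) measurable_const measurable_const p
      (u := rankMarks ξ) (measurable_rankMarks measurable_const measurable_id))

theorem measurable_outgoingOf_marks (hφ : Measurable φ) (ξ : VertexConfig) (σ : EdgeConfig)
    (p : Vertex) : Measurable (outgoingOf φ f ξ σ p) :=
  (measurable_outgoingOf_marks_and hφ ξ σ p).1

theorem measurable_outgoingLaw (hφ : Measurable φ) (p : Vertex) :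
    Measurable fun x : VertexConfig × EdgeConfig => outgoingLaw φ f x.1 x.2 p := by
  have h : Measurable fun x : (VertexConfig × EdgeConfig) × (ℕ × ℕ → unitInterval) =>
      outgoingOf φ f x.1.1 x.1.2 p (rankMarks x.1.1 x.2) :=
    measurable_outgoingOf hφ (measurable_fst.comp measurable_fst)
      (measurable_snd.comp measurable_fst) p
      (measurable_rankMarks (measurable_fst.comp measurable_fst) measurable_snd)
  have := measurable_map_prodMk rankMarkLaw h
  convert this using 2 with x
  exact (measurable_outgoingOf_marks_and hφ x.1 x.2 p).2

theorem isProbabilityMeasure_outgoingLaw (hφ : Measurable φ) (ξ : VertexConfig) (σ : EdgeConfig)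
    (p : Vertex) : IsProbabilityMeasure (outgoingLaw φ f ξ σ p) :=
  Measure.isProbabilityMeasure_map (measurable_outgoingOf_marks hφ ξ σ p).aemeasurable

theorem measurableSet_younger (p : Vertex) :
    MeasurableSet (pairsWith (bornBy (birth p))ᶜ p) :=
  measurableSet_pairsWith (measurableSet_bornBy _).compl p

theorem measurable_incomingLaw (hφ : Measurable φ) (p : Vertex) :
    Measurable fun ξ => incomingLaw φ f ξ p :=
  (Measure.measurable_map _ (Config.measurable_restrict (measurableSet_younger p))).comp
    ((measurable_edgeLaw hφ).comp (Config.measurable_add measurable_id measurable_const))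

theorem incomingLaw_eq_map (hφ : Measurable φ) (ξ : VertexConfig) (p : Vertex) :
    incomingLaw φ f ξ p = markLaw.map fun u =>
      (graphOf φ f (ξ.add p) u).restrict (pairsWith (bornBy (birth p))ᶜ p) :=
  Measure.map_map (Config.measurable_restrict (measurableSet_younger p))
    (measurable_graphOf_marks hφ _)

theorem isProbabilityMeasure_incomingLaw (hφ : Measurable φ) (ξ : VertexConfig) (p : Vertex) :
    IsProbabilityMeasure (incomingLaw φ f ξ p) :=
  have := isProbabilityMeasure_edgeLaw (f := f) hφ (ξ.add p)
  Measure.isProbabilityMeasure_map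
    (Config.measurable_restrict (measurableSet_younger p)).aemeasurable

end Kernel

/-! ### Independence of outgoing and incoming edges -/

section SplitUp

variable {φ : ℝ → ℝ} {f : ℕ → ℝ}

/-- On the left the marks enter twice, through the old graph and through the choices of `p`. The
right side shows that the result is nevertheless measurable in `u`, being a restriction of one
graph. -/
theorem outgoingOf_eq_restrict {ξ : VertexConfig} {u : Marks} {p : Vertex} (hp : p ∉ ξ.1) :
    outgoingOf φ f (ξ.restrict (bornBefore (birth p)))
        ((graphOf φ f ξ u).restrict (pairsIn (bornBefore (birth p)))) p u =
      ((graphOf φ f (ξ.add p) u).restrict (pairsWith ξ.1 p)).restrict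
        (pairsWith (bornBefore (birth p)) p) := by
  rw [restrict_graphOf_add hp]
  refine Subtype.ext (Set.ext fun e => ⟨fun he => ⟨Or.inl he, ?_⟩, ?_⟩)
  · obtain ⟨y, -, hlt, -, he⟩ := he
    exact ⟨y, hlt, he.trans Sym2.eq_swap⟩
  · rintro ⟨he | ⟨-, y, hy, he⟩, y', hy', he'⟩
    · exact he
    · rw [he, Sym2.eq_iff] at he'
      have hy : birth p < birth y := not_le.1 hy
      have hy' : birth y' < birth p := hy'
      rcases he' with ⟨rfl, -⟩ | ⟨rfl, -⟩
      · exact absurd hy hy'.not_gt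
      · exact absurd hy (lt_irrefl _)

theorem lintegral_markLaw_glue (A : Set (Vertex × Vertex)) [DecidablePred (· ∈ A)]
    {g : Marks → ENNReal} (hg : Measurable g) :
    ∫⁻ u, g u ∂markLaw =
      ∫⁻ u, ∫⁻ v, g (fun i => if i ∈ A then u i else v i) ∂markLaw ∂markLaw := by
  have hm : Measurable fun (x : Marks × Marks) i => if i ∈ A then x.1 i else x.2 i := by
    refine measurable_pi_lambda _ fun i => ?_
    split_ifs
    · exact (measurable_pi_apply i).comp measurable_fst
    · exact (measurable_pi_apply i).comp measurable_snd
  conv_lhs => rw [markLaw, ← infinitePi_map_glue volume A]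
  rw [lintegral_map hg hm]
  exact lintegral_prod _ (hg.comp hm).aemeasurable

theorem lintegral_edgeLaw (hφ : Measurable φ) (ξ : VertexConfig) {k : EdgeConfig → ENNReal}
    (hk : Measurable k) : ∫⁻ σ, k σ ∂edgeLaw φ f ξ = ∫⁻ u, k (graphOf φ f ξ u) ∂markLaw :=
  lintegral_map hk (measurable_graphOf_marks hφ ξ)

theorem measurable_lintegral_outgoing_incoming (hφ : Measurable φ) (p : Vertex)
    {k : VertexConfig × EdgeConfig → ENNReal} (hk : Measurable k) :
    Measurable fun x : VertexConfig × EdgeConfig =>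
      ∫⁻ e : EdgeConfig × EdgeConfig, k (x.1, e.1.union e.2)
        ∂((outgoingLaw φ f (x.1.restrict (bornBefore (birth p)))
            (x.2.restrict (pairsIn (bornBefore (birth p)))) p).prod (incomingLaw φ f x.1 p)) := by
  have hb := measurableSet_bornBefore (birth p)
  let κ : Kernel (VertexConfig × EdgeConfig) EdgeConfig :=
    ⟨fun x => outgoingLaw φ f (x.1.restrict (bornBefore (birth p)))
      (x.2.restrict (pairsIn (bornBefore (birth p)))) p, (measurable_outgoingLaw hφ p).comp
        (((Config.measurable_restrict hb).comp measurable_fst).prodMk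
          ((Config.measurable_restrict (measurableSet_pairsIn hb)).comp measurable_snd))⟩
  let η : Kernel (VertexConfig × EdgeConfig) EdgeConfig :=
    ⟨fun x => incomingLaw φ f x.1 p, (measurable_incomingLaw hφ p).comp measurable_fst⟩
  have : IsMarkovKernel κ := ⟨fun x => isProbabilityMeasure_outgoingLaw hφ _ _ p⟩
  have : IsMarkovKernel η := ⟨fun x => isProbabilityMeasure_incomingLaw hφ _ p⟩
  have h := Measurable.lintegral_kernel_prod_right' (κ := κ ×ₖ η)
    (f := fun y => k (y.1.1, y.2.1.union y.2.2))
    (hk.comp ((measurable_fst.comp measurable_fst).prodMk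
      (Config.measurable_union.comp measurable_snd)))
  simp only [Kernel.prod_apply] at h
  exact h

/-- The edges of a vertex `p` that is added to `ξ`, integrated over the graph with vertex set
`ξ + δ_p`, split up into outgoing and incoming edges. -/
theorem lintegral_edgeLaw_add (hφ : Measurable φ) {ξ : VertexConfig} {p : Vertex} (hp : p ∉ ξ.1)
    {k : EdgeConfig → ENNReal} (hk : Measurable k) :
    ∫⁻ σ, k (σ.restrict (pairsWith ξ.1 p)) ∂edgeLaw φ f (ξ.add p) =
      ∫⁻ σ, ∫⁻ e : EdgeConfig × EdgeConfig, k (e.1.union e.2)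
        ∂((outgoingLaw φ f (ξ.restrict (bornBefore (birth p)))
            (σ.restrict (pairsIn (bornBefore (birth p)))) p).prod (incomingLaw φ f ξ p))
        ∂edgeLaw φ f ξ := by
  classical
  have := isProbabilityMeasure_incomingLaw (f := f) hφ ξ p
  let old : Marks → EdgeConfig := fun u =>
    (graphOf φ f ξ u).restrict (pairsIn (bornBefore (birth p)))
  let out : EdgeConfig → Marks → EdgeConfig := fun σ =>
    outgoingOf φ f (ξ.restrict (bornBefore (birth p))) σ p
  let inc : Marks → EdgeConfig := fun u =>
    (graphOf φ f (ξ.add p) u).restrict (pairsWith (bornBy (birth p))ᶜ p)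
  let K : EdgeConfig → ENNReal := fun e₁ => ∫⁻ e₂, k (e₁.union e₂) ∂incomingLaw φ f ξ p
  have hK : Measurable K := (hk.comp Config.measurable_union).lintegral_prod_right'
  have hgraph : ∀ ξ', Measurable (graphOf φ f ξ') := measurable_graphOf_marks hφ
  have hξ : MeasurableSet (pairsWith ξ.1 p) := measurableSet_pairsWith ξ.countable.measurableSet p
  have hrestr := Config.measurable_restrict (W := fun t => pairsIn (bornBy t)) hξ
  have hadd : ∀ u, (graphOf φ f (ξ.add p) u).restrict (pairsWith ξ.1 p) =
      (out (old u) u).union (inc u) := fun u => restrict_graphOf_add hp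
  have hinc : Measurable inc :=
    (Config.measurable_restrict (measurableSet_younger p)).comp (hgraph _)
  have hne : ∀ y ∈ ξ.1, y ≠ p := fun y hy h => hp (h ▸ hy)
  have hm1 : Measurable fun u => k ((out (old u) u).union (inc u)) := by
    simp_rw [← hadd]
    exact hk.comp (hrestr.comp (hgraph _))
  have hm2 : Measurable fun u => K (out (old u) u) := by
    have : ∀ u, out (old u) u = ((graphOf φ f (ξ.add p) u).restrict (pairsWith ξ.1 p)).restrict
        (pairsWith (bornBefore (birth p)) p) := fun u => outgoingOf_eq_restrict hp
    simp_rw [this]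
    exact hK.comp ((Config.measurable_restrict (measurableSet_pairsWith
      (measurableSet_bornBefore _) p)).comp (hrestr.comp (hgraph _)))
  have hold : ∀ u v : Marks, (∀ q ∈ ξ.1, ∀ p ∈ ξ.1, u (q, p) = v (q, p)) → old u = old v :=
    fun u v h => congrArg (fun σ : EdgeConfig => σ.restrict _) (graphOf_congr h)
  have hout : ∀ σ (u v : Marks), (∀ y ∈ ξ.1, u (p, y) = v (p, y)) → out σ u = out σ v :=
    fun σ u v h => outgoingOf_congr fun y hy => h y hy.1
  refine (lintegral_edgeLaw hφ (ξ.add p) (hk.comp hrestr)).trans ?_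
  simp only [Function.comp_apply, hadd]
  -- Resample the marks `(q, p)`: the incoming edges read no others, while the old graph and the
  -- outgoing edges read none of them because `p` is not in `ξ`.
  rw [lintegral_markLaw_glue {x | x.2 ≠ p} hm1]
  have h1 : ∀ u, ∫⁻ v, k ((out (old fun i => if i ∈ {x : Vertex × Vertex | x.2 ≠ p} then u i else
      v i) fun i => if i ∈ {x : Vertex × Vertex | x.2 ≠ p} then u i else v i).union
      (inc fun i => if i ∈ {x : Vertex × Vertex | x.2 ≠ p} then u i else v i)) ∂markLaw =
      K (out (old u) u) := by
    intro u
    change _ = ∫⁻ e₂, k ((out (old u) u).union e₂) ∂incomingLaw φ f ξ p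
    rw [incomingLaw_eq_map hφ]
    refine Eq.trans ?_ (lintegral_map (hk.comp (Config.measurable_union.comp
      (measurable_prodMk_left (x := out (old u) u)))) hinc).symm
    refine lintegral_congr fun v => ?_
    rw [hold _ u fun q _ y hy => if_pos (hne y hy), hout _ _ u fun y hy => if_pos (hne y hy)]
    congr 2
    exact incoming_congr fun q _ => if_neg (not_not.2 rfl)
  simp_rw [h1]
  -- Now resample the marks `(p, y)`: given the old graph, the outgoing edges read no others, and
  -- the old graph reads none of them.
  rw [lintegral_markLaw_glue {x | x.1 ≠ p} hm2]
  refine Eq.trans ?_ (lintegral_edgeLaw hφ ξ ((measurable_lintegral_outgoing_incoming (f := f) hφ p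
    (hk.comp measurable_snd)).comp (measurable_prodMk_left (x := ξ)))).symm
  refine lintegral_congr fun u => ?_
  refine Eq.trans ?_ (lintegral_prod _ (hk.comp Config.measurable_union).aemeasurable).symm
  refine Eq.trans ?_ (lintegral_map hK (measurable_outgoingOf_marks hφ _ _ p)).symm
  refine lintegral_congr fun v => ?_
  rw [hold _ u fun q hq _ _ => if_pos (hne q hq),
    hout _ _ v fun y _ => if_neg (not_not.2 rfl)]

end SplitUp

/-! ### Assembling the formula -/

theorem measurable_restrict_pairsWith {A : Type*} [MeasurableSpace A] {ξ : A → VertexConfig}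
    (hξ : Measurable ξ) {σ : A → EdgeConfig} (hσ : Measurable σ) {p : A → Vertex}
    (hp : Measurable p) : Measurable fun a => (σ a).restrict (pairsWith (ξ a).1 (p a)) := by
  refine Config.measurable_of_void fun B hB _ => ?_
  have h2 : MeasurableSet {x : (A × Edge) × Vertex | x.1.2 ∈ B ∧ x.1.2.1 = s(x.2, p x.1.1)} :=
    (hB.preimage (measurable_snd.comp measurable_fst)).inter
      (measurableSet_eq_fun (measurable_subtype_coe.comp (measurable_snd.comp measurable_fst))
        (measurable_sym2Mk.comp (f := fun x : (A × Edge) × Vertex => (x.2, p x.1.1))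
          (measurable_snd.prodMk (hp.comp (measurable_fst.comp measurable_fst)))))
  have h1 := Config.measurableSet_exists (hξ.comp measurable_fst)
    (S := fun (x : A × Edge) y => x.2 ∈ B ∧ x.2.1 = s(y, p x.1)) h2
  have h0 := (Config.measurableSet_exists hσ
    (S := fun a e => ∃ y ∈ (ξ a).1, e ∈ B ∧ e.1 = s(y, p a)) h1).compl
  convert h0 using 1
  ext a
  rw [mem_ofPred_eq, mem_compl_iff, ← not_nonempty_iff_eq_empty]
  refine not_congr ⟨?_, ?_⟩
  · rintro ⟨e, ⟨he, y, hy, he'⟩, hB⟩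
    exact ⟨e, he, y, hy, hB, he'⟩
  · rintro ⟨e, he, y, hy, hB, he'⟩
    exact ⟨e, ⟨he, y, hy, he'⟩, hB⟩

/-- The conditional law prescribes the joint law of `Ξ` and `G` on measurable rectangles, which
determines it as the composition of the law of `Ξ` with the edge kernel. -/
theorem IsSpatialPA.lintegral_eq {Ω : Type*} [MeasurableSpace Ω] {P : Measure Ω}
    [IsProbabilityMeasure P] {α : Measure Vertex} {φ : ℝ → ℝ} (hφ : Measurable φ) {f : ℕ → ℝ}
    {Ξ : Ω → VertexConfig} {G : Ω → EdgeConfig} (hG : IsSpatialPA α φ f P Ξ G)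
    {k : VertexConfig × EdgeConfig → ENNReal} (hk : Measurable k) :
    ∫⁻ ω, k (Ξ ω, G ω) ∂P = ∫⁻ ω, ∫⁻ σ, k (Ξ ω, σ) ∂edgeLaw φ f (Ξ ω) ∂P := by
  let κ : Kernel VertexConfig EdgeConfig := ⟨edgeLaw φ f, measurable_edgeLaw hφ⟩
  have : IsMarkovKernel κ := ⟨fun ξ => isProbabilityMeasure_edgeLaw hφ ξ⟩
  have hΞ := hG.poisson.measurable
  have hΞG := hΞ.prodMk hG.measurable_edges
  have : IsProbabilityMeasure (P.map Ξ) := Measure.isProbabilityMeasure_map hΞ.aemeasurable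
  have hlaw : P.map (fun ω => (Ξ ω, G ω)) = P.map Ξ ⊗ₘ κ := by
    refine (Measure.ext_prod fun {A B} hA hB => ?_).symm
    rw [Measure.compProd_apply_prod hA hB, setLIntegral_map hA (κ.measurable_coe hB) hΞ,
      Measure.map_apply hΞG (hA.prod hB)]
    exact (hG.cond_law A B hA hB).symm
  rw [← lintegral_map hk hΞG, hlaw, Measure.lintegral_compProd hk,
    lintegral_map hk.lintegral_kernel_prod_right' hΞ]
  rfl

theorem Config.add_erase {Y : Type*} {W : ℝ → Set Y} {ξ : Config W} {p : Y} (hp : p ∈ ξ.1) :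
    (ξ.erase p).add p = ξ :=
  Subtype.ext (insert_sdiff_self_of_mem hp)

end SpatialPA

theorem corollary3p6 {Ω : Type*} [MeasurableSpace Ω] (P : Measure Ω) [IsProbabilityMeasure P]
    (α : Measure Vertex) (hα : ∀ p, α {p} = 0) (hα' : ∀ t, α (bornBy t) < ⊤)
    (φ : ℝ → ℝ) (hφ : Measurable φ) (hφ' : ∀ r, 0 ≤ r → φ r ∈ Icc (0 : ℝ) 1)
    (f : ℕ → ℝ) (hf : ∀ k, 0 < f k)
    (Ξ : Ω → VertexConfig) (G : Ω → EdgeConfig) (hG : IsSpatialPA α φ f P Ξ G)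
    (h : VertexConfig × Vertex × EdgeConfig → ENNReal) (hh : Measurable h) :
    ∫⁻ ω, ∑' p : (Ξ ω).1, h ((Ξ ω).erase p, (p : Vertex),
        (G ω).restrict (pairsWith ((Ξ ω).erase p).1 p)) ∂P =
      ∫⁻ p, ∫⁻ ω, ∫⁻ e : EdgeConfig × EdgeConfig, h (Ξ ω, p, e.1.union e.2)
        ∂((outgoingLaw φ f ((Ξ ω).restrict (bornBefore (birth p)))
            ((G ω).restrict (pairsIn (bornBefore (birth p)))) p).prod
          (incomingLaw φ f (Ξ ω) p)) ∂P ∂α := by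
  have hterm : Measurable fun x : (VertexConfig × EdgeConfig) × Vertex =>
      h (x.1.1.erase x.2, x.2, x.1.2.restrict (pairsWith (x.1.1.erase x.2).1 x.2)) := by
    have he := Config.measurable_erase (ξ := fun x : (VertexConfig × EdgeConfig) × Vertex => x.1.1)
      (by fun_prop) (p := fun x => x.2) (by fun_prop)
    exact hh.comp (he.prodMk (measurable_snd.prodMk
      (measurable_restrict_pairsWith he (σ := fun x => x.1.2) (by fun_prop) measurable_snd)))
  rw [hG.lintegral_eq hφ (k := fun x : VertexConfig × EdgeConfig => ∑' p : x.1.1,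
    h (x.1.erase p, (p : Vertex), x.2.restrict (pairsWith (x.1.erase p).1 p))) (Config.measurable_tsum measurable_fst
      (g := fun (x : VertexConfig × EdgeConfig) p =>
        h (x.1.erase p, p, x.2.restrict (pairsWith (x.1.erase p).1 p))) hterm)]
  let g : VertexConfig × Vertex → ENNReal := fun x =>
    ∫⁻ σ, h (x.1, x.2, σ.restrict (pairsWith x.1.1 x.2)) ∂edgeLaw φ f (x.1.add x.2)
  have hg : Measurable g := by
    let κ : Kernel (VertexConfig × Vertex) EdgeConfig := ⟨fun x => edgeLaw φ f (x.1.add x.2),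
      (measurable_edgeLaw hφ).comp (Config.measurable_add measurable_fst measurable_snd)⟩
    have : IsMarkovKernel κ := ⟨fun x => isProbabilityMeasure_edgeLaw hφ _⟩
    refine Measurable.lintegral_kernel_prod_right' (κ := κ) (f := fun y =>
      h (y.1.1, y.1.2, y.2.restrict (pairsWith y.1.1.1 y.1.2))) (hh.comp ?_)
    exact (measurable_fst.comp measurable_fst).prodMk ((measurable_snd.comp measurable_fst).prodMk
      (measurable_restrict_pairsWith (measurable_fst.comp measurable_fst) measurable_snd
        (measurable_snd.comp measurable_fst)))
  have hsum : ∀ ω, ∫⁻ σ, ∑' p : (Ξ ω).1, h ((Ξ ω).erase p, (p : Vertex),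
      σ.restrict (pairsWith ((Ξ ω).erase p).1 p)) ∂edgeLaw φ f (Ξ ω) =
      ∑' p : (Ξ ω).1, g ((Ξ ω).erase p, (p : Vertex)) := by
    intro ω
    refine (lintegral_tsum fun p : (Ξ ω).1 => (hterm.comp
      (f := fun σ : EdgeConfig => ((Ξ ω, σ), (p : Vertex))) (by fun_prop)).aemeasurable).trans ?_
    refine tsum_congr fun p => ?_
    -- For a point `p` of `Ξ`, adding `p` to `Ξ - δ_p` restores `Ξ`, so the edge law in `g` is that
    -- of the original graph.
    simp only [g, Function.comp_apply, Config.add_erase p.2]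
  simp_rw [hsum]
  rw [hG.poisson.mecke hα' hg]
  refine lintegral_congr fun p => ?_
  have hk : Measurable fun x : VertexConfig × EdgeConfig => h (x.1, p, x.2) := by fun_prop
  -- On the right side too, `G` is replaced by its conditional law given `Ξ`, so that the two sides
  -- can be compared for each fixed configuration.
  rw [hG.lintegral_eq hφ (measurable_lintegral_outgoing_incoming hφ p hk)]
  refine lintegral_congr_ae ?_
  filter_upwards [hG.poisson.measure_mem_eq_zero (hα p)] with ω hω
  exact lintegral_edgeLaw_add hφ hω (hk.comp measurable_prodMk_left)
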